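/- Let $G$ be a discrete group, let $1\le p<\infty$, and let $q\in(1,\infty]$ be the conjugate index, $1/p+1/q=1$ (with $d/\infty=0$). A weight on $G$ is a function $\omega:G\to[0,\infty)$ with $\omega(e)=1$, $\omega(x^{-1})=\omega(x)$ and $\omega(xy)\le\omega(x)\omega(y)$. Let $\ell^p(G,\omega)$ be the Banach space of all $f:G\to\mathbb C$ with $\|f\|_{p,\omega}:=\|f\omega\|_p<\infty$, and let $C^*_r(G)\subseteq B(\ell^2(G))$ be the reduced $C^*$-algebra of $G$, i.e. the norm closure of the $*$-algebra generated by the left translations. We say that $\ell^p(G,\omega)$ admits norm-controlled inversion in $C^*_r(G)$ if it is a Banach algebra under convolution (with $\|f*g\|_{p,\omega}\le K\|f\|_{p,\omega}\|g\|_{p,\omega}$ for some constant $K$), it is continuously contained in $C^*_r(G)$ via $f\mapsto(\xi\mapsto f*\xi)$, with the same unit, it is inverse-closed in $C^*_r(G)$ (if $f\in\ell^p(G,\omega)$ is invertible in $C^*_r(G)$ then $f^{-1}\in\ell^p(G,\omega)$), and there is a function $h:[0,\infty)\times[0,\infty)\to[0,\infty)$ such that $$\|f^{-1}\|_{p,\omega}\le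 h\big(\|f\|_{p,\omega},\|f^{-1}\|_{C^*_r(G)}\big)\quad\text{for every invertible } f\in\ell^p(G,\omega).$$ For a finitely generated $G$ let $U$ be a finite symmetric generating set containing $e$, let $\tau(x)=\min\{n\ge 0: x\in U^n\}$ with $U^0=\{e\}$, and call $G$ of polynomial growth if $|U^n|\le Kn^d$ for all $n\ge1$, for some $K>0$ and some integer $d\ge0$; the least such $d$ is denoted $d(G)$. Call $G$ of intermediate growth if it is not of polynomial growth but $|U^n|=o(c^n)$ for every $c>1$. Then $\ell^p(G,\omega)$ admits norm-controlled inversion in $C^*_r(G)$ in each of the following cases. (i) $G=\bigcup_{i\ge 1}G_i$ for an increasing sequence of finite subgroups $G_i$, and $\omega=1+\sum_{i\ge 1}n_i\,1_{G_{i+1}\setminus G_i}$ for an increasing sequence $(n_i)$ in $[1,\infty)$, where $\omega^{-1}\in\ell^s(G)$ for some $0<s<q$. (ii) $G$ is finitely generated of polynomial growth and $\omega(x)=(1+\tau(x))^\beta$ with $\beta>0$ and $\beta>d(G)/q$. (iii) $G$ is finitely generated of polynomial growth and $\omega(x)=e^{C\tau(x)^\alpha}$ with $C>0$ and $0<\alpha<1$.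 (iv) $G$ is finitely generated of intermediate growth, its growth is bounded by $e^{n^{\alpha_0}}$ in the sense that $|U^n|\le K e^{(Kn)^{\alpha_0}}$ for some $K>0$ and all $n\ge1$, and $\omega(x)=e^{C\tau(x)^\alpha}$ with $C>0$ and $0<\alpha_0<\alpha<1$. -/

import Mathlib

open scoped ENNReal NNReal Pointwise

universe u

namespace WeightedConv

variable {G : Type u} [Group G]

/-! ## Weights and weighted `ℓ^p` spaces -/

/-- A weight on the discrete group `G`: a symmetric submultiplicative function
`ω : G → [0, ∞)` with `ω(e) = 1`. -/
structure Weight (G : Type u) [Group G] where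
  toFun : G → ℝ
  nonneg : ∀ x, 0 ≤ toFun x
  map_one : toFun 1 = 1
  map_inv : ∀ x, toFun x⁻¹ = toFun x
  map_mul_le : ∀ x y, toFun (x * y) ≤ toFun x * toFun y

instance : CoeFun (Weight G) (fun _ => G → ℝ) := ⟨Weight.toFun⟩

theorem Weight.one_le (ω : Weight G) (x : G) : 1 ≤ ω x := by
  have h := ω.map_mul_le x x⁻¹
  rw [mul_inv_cancel, ω.map_one, ω.map_inv] at h
  nlinarith [ω.nonneg x]

theorem Weight.ne_zero (ω : Weight G) (x : G) : ((ω x : ℝ) : ℂ) ≠ 0 := by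
  have := ω.one_le x
  exact_mod_cast (by linarith : (0 : ℝ) < ω x).ne'

/-- The complex vector space of the functions `f : G → ℂ` with `f ω ∈ ℓ^p(G)`. -/
def weightedLpSubmodule (p : ℝ≥0∞) (ω : Weight G) : Submodule ℂ (G → ℂ) where
  carrier := {f | Memℓp (fun x => f x * (ω x : ℂ)) p}
  zero_mem' := by
    have h : (fun x : G => (0 : G → ℂ) x * (ω x : ℂ)) = 0 := by
      funext x
      simp
    change Memℓp (fun x : G => (0 : G → ℂ) x * (ω x : ℂ)) p
    rw [h]
    exact zero_memℓp
  add_mem' := fun {f g} hf hg => by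
    have h : (fun x : G => (f + g) x * (ω x : ℂ)) =
        (fun x => f x * (ω x : ℂ)) + (fun x => g x * (ω x : ℂ)) := by
      funext x
      exact add_mul _ _ _
    change Memℓp (fun x : G => (f + g) x * (ω x : ℂ)) p
    rw [h]
    exact Memℓp.add hf hg
  smul_mem' := fun c f hf => by
    have h : (fun x : G => (c • f) x * (ω x : ℂ)) = c • (fun x => f x * (ω x : ℂ)) := by
      funext x
      exact mul_assoc _ _ _
    change Memℓp (fun x : G => (c • f) x * (ω x : ℂ)) p
    rw [h]
    exact Memℓp.const_smul hf c

/-- `ℓ^p(G, ω)`: the functions `f : G → ℂ` with `f ω ∈ ℓ^p(G)`, with the norm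
`‖f‖_{p,ω} = ‖f ω‖_p` (instance below). It is a type of its own, so that it does not inherit
the topology of pointwise convergence. -/
def WeightedLp (p : ℝ≥0∞) (ω : Weight G) : Type u := weightedLpSubmodule p ω

namespace WeightedLp

variable (p : ℝ≥0∞) (ω : Weight G)

instance : CoeFun (WeightedLp p ω) (fun _ => G → ℂ) := ⟨Subtype.val⟩

instance : AddCommGroup (WeightedLp p ω) := inferInstanceAs (AddCommGroup (weightedLpSubmodule p ω))

instance : Module ℂ (WeightedLp p ω) := inferInstanceAs (Module ℂ (weightedLpSubmodule p ω))

/-- The map `f ↦ f ω` from `ℓ^p(G, ω)` to `ℓ^p(G)`. -/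
def mulWeight : WeightedLp p ω →ₗ[ℂ] lp (fun _ : G => ℂ) p where
  toFun f := ⟨fun x => f x * (ω x : ℂ), f.2⟩
  map_add' f g := by
    apply Subtype.ext
    funext x
    exact add_mul (f x) (g x) (ω x : ℂ)
  map_smul' c f := by
    apply Subtype.ext
    funext x
    exact mul_assoc c (f x) (ω x : ℂ)

theorem mulWeight_injective : Function.Injective (mulWeight p ω) := by
  intro f g h
  apply Subtype.ext
  funext x
  have hx : f x * (ω x : ℂ) = g x * (ω x : ℂ) := congrFun (congrArg Subtype.val h) x
  exact mul_right_cancel₀ (ω.ne_zero x) hx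

theorem mulWeight_surjective : Function.Surjective (mulWeight p ω) := by
  intro g
  have key : (fun x => ((g : G → ℂ) x / (ω x : ℂ)) * (ω x : ℂ)) = (g : G → ℂ) := by
    ext x
    exact div_mul_cancel₀ _ (ω.ne_zero x)
  refine ⟨⟨fun x => (g : G → ℂ) x / (ω x : ℂ), ?_⟩, ?_⟩
  · change Memℓp _ p
    rw [key]
    exact g.2
  · apply Subtype.ext
    exact key

/-- The norm `‖f‖_{p,ω} = ‖f ω‖_p` on `ℓ^p(G, ω)`. -/
noncomputable instance [Fact (1 ≤ p)] : NormedAddCommGroup (WeightedLp p ω) :=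
  NormedAddCommGroup.induced _ _ (mulWeight p ω) (mulWeight_injective p ω)

noncomputable instance [Fact (1 ≤ p)] : NormedSpace ℂ (WeightedLp p ω) :=
  NormedSpace.induced ℂ _ _ (mulWeight p ω)

instance [Fact (1 ≤ p)] : CompleteSpace (WeightedLp p ω) := by
  let e : WeightedLp p ω ≃ₗᵢ[ℂ] lp (fun _ : G => ℂ) p :=
    { LinearEquiv.ofBijective (mulWeight p ω)
        ⟨mulWeight_injective p ω, mulWeight_surjective p ω⟩ with
      norm_map' := fun _ => rfl }
  exact (completeSpace_congr (e := e.toEquiv) e.isometry.isUniformEmbedding).2 inferInstance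

end WeightedLp

/-! ## The reduced group C*-algebra -/

/-- The Hilbert space `ℓ²(G)`. -/
abbrev L2 (G : Type u) : Type u := lp (fun _ : G => ℂ) 2

theorem memℓp_translate (g : G) (ξ : L2 G) : Memℓp (fun x => ξ (g⁻¹ * x)) 2 := by
  have h := lp.memℓp ξ
  rw [memℓp_gen_iff (by norm_num)] at h ⊢
  exact (Equiv.mulLeft g⁻¹).summable_iff.2 h

/-- Left translation `(λ(g) ξ)(x) = ξ(g⁻¹ x)` on `ℓ²(G)`. -/
noncomputable def leftRegular (g : G) : L2 G →L[ℂ] L2 G :=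
  LinearMap.mkContinuous
    { toFun := fun ξ => (⟨fun x => ξ (g⁻¹ * x), memℓp_translate g ξ⟩ : L2 G)
      map_add' := fun ξ η => rfl
      map_smul' := fun c ξ => rfl }
    1 (fun ξ => by
      rw [one_mul]
      apply le_of_eq
      rw [lp.norm_eq_tsum_rpow (by norm_num), lp.norm_eq_tsum_rpow (by norm_num)]
      congr 1
      exact (Equiv.mulLeft g⁻¹).tsum_eq (fun x => ‖ξ x‖ ^ (2 : ℝ≥0∞).toReal))

theorem leftRegular_apply (g : G) (ξ : L2 G) (x : G) :
    leftRegular g ξ x = ξ (g⁻¹ * x) := rfl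

/-- The reduced C*-algebra `C*_r(G)`: the norm closure in `B(ℓ²(G))` of the `*`-algebra
generated by the left regular representation. -/
noncomputable def reducedCStar (G : Type u) [Group G] : StarSubalgebra ℂ (L2 G →L[ℂ] L2 G) :=
  (StarAlgebra.adjoin ℂ (Set.range (leftRegular (G := G)))).topologicalClosure

/-! ## Norm-controlled inversion -/

/-- Let `ι : A → B` be a bounded linear map from a Banach space to a unital Banach algebra.
`IsBanachSubalgebra ι` says that `ι` is injective and that `A`, viewed inside `B` through `ι`,
contains the unit of `B` and is a Banach algebra for the product of `B` and its own norm
(whose submultiplicativity is required up to a constant). -/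
structure IsBanachSubalgebra {A B : Type*} [NormedAddCommGroup A] [NormedSpace ℂ A]
    [CompleteSpace A] [NormedRing B] [NormedAlgebra ℂ B] (ι : A →L[ℂ] B) : Prop where
  injective : Function.Injective ι
  one_mem : ∃ e : A, ι e = 1
  mul_mem : ∀ a b : A, ∃ c : A, ι c = ι a * ι b
  norm_mul_le : ∃ K : ℝ, ∀ a b c : A, ι c = ι a * ι b → ‖c‖ ≤ K * ‖a‖ * ‖b‖

/-- `A`, a Banach subalgebra of `B` with the same unit, admits norm-controlled inversion in `B`:
it is inverse-closed in `B`, and `‖a⁻¹‖_A ≤ h(‖a‖_A, ‖a⁻¹‖_B)` for one function `h`. -/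
structure NormControlledInversion {A B : Type*} [NormedAddCommGroup A] [NormedSpace ℂ A]
    [CompleteSpace A] [NormedRing B] [NormedAlgebra ℂ B] (ι : A →L[ℂ] B) : Prop where
  isBanachSubalgebra : IsBanachSubalgebra ι
  inverseClosed : ∀ (a : A) (y : B), ι a * y = 1 → y * ι a = 1 → ∃ b : A, ι b = y
  normControl : ∃ h : ℝ≥0 → ℝ≥0 → ℝ≥0, ∀ a b : A, ι a * ι b = 1 → ι b * ι a = 1 →
    ‖b‖₊ ≤ h ‖a‖₊ ‖ι b‖₊

/-- `ℓ^p(G, ω)` is a Banach algebra under convolution, is contained in `C*_r(G)` (a function `f`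
being identified with the operator `ξ ↦ f * ξ` on `ℓ²(G)`), and admits norm-controlled inversion
in `C*_r(G)`. -/
def AdmitsNormControlledInversion (p : ℝ≥0∞) [Fact (1 ≤ p)] (ω : Weight G) : Prop :=
  ∃ ι : WeightedLp p ω →L[ℂ] reducedCStar G,
    (∀ (f : WeightedLp p ω) (ξ : L2 G) (x : G),
      HasSum (fun y => f y * ξ (y⁻¹ * x)) ((ι f : L2 G →L[ℂ] L2 G) ξ x)) ∧
    (∀ f g : WeightedLp p ω, ∃ k : WeightedLp p ω,
      (∀ x : G, HasSum (fun y => f y * g (y⁻¹ * x)) (k x)) ∧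
      ι k = ι f * ι g) ∧
    NormControlledInversion ι

/-! ## Length functions and growth -/

/-- `U` is a finite symmetric generating set of `G` containing the identity. -/
structure IsSymmGenSet (U : Set G) : Prop where
  finite : U.Finite
  one_mem : (1 : G) ∈ U
  inv_mem : ∀ x ∈ U, x⁻¹ ∈ U
  closure_eq_top : Subgroup.closure U = ⊤

/-- The length function `τ_U(x) = min {n : x ∈ U^n}`; here `U^0 = {e}`, so `τ_U(e) = 0`. -/
noncomputable def len (U : Set G) (x : G) : ℕ := sInf {n : ℕ | x ∈ U ^ n}

/-- `|U^n| ≤ K n^d` for some `K > 0` and all `n ≥ 1`. -/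
def GrowthLE (U : Set G) (d : ℕ) : Prop :=
  ∃ K : ℝ, 0 < K ∧ ∀ n : ℕ, 1 ≤ n → ((U ^ n).ncard : ℝ) ≤ K * (n : ℝ) ^ d

/-- Polynomial growth. -/
def PolynomialGrowth (U : Set G) : Prop := ∃ d : ℕ, GrowthLE U d

/-- The order of growth `d(G)`, i.e. the smallest `d` such that `|U^n| = O(n^d)`
(meaningful for polynomial growth). -/
noncomputable def growthOrder (U : Set G) : ℕ := sInf {d : ℕ | GrowthLE U d}

/-- Intermediate growth: not polynomial, but slower than every exponential function. -/
def IntermediateGrowth (U : Set G) : Prop :=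
  ¬ PolynomialGrowth U ∧
    ∀ c : ℝ, 1 < c → (fun n : ℕ => ((U ^ n).ncard : ℝ)) =o[Filter.atTop] (fun n : ℕ => c ^ n)

/-- The growth of `G` is bounded by `exp (n^a)`, in the usual sense of comparison of growth
functions: `|U^n| ≤ K exp ((K n)^a)` for some `K > 0`. -/
def GrowthBoundedByExp (U : Set G) (a : ℝ) : Prop :=
  ∃ K : ℝ, 0 < K ∧ ∀ n : ℕ, 1 ≤ n → ((U ^ n).ncard : ℝ) ≤ K * Real.exp ((K * (n : ℝ)) ^ a)

theorem IsSymmGenSet.exists_mem_pow {U : Set G} (hU : IsSymmGenSet U) (x : G) :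
    ∃ n : ℕ, x ∈ U ^ n := by
  have hx : x ∈ Subgroup.closure U := by rw [hU.closure_eq_top]; trivial
  induction hx using Subgroup.closure_induction'' with
  | one => exact ⟨0, by simp⟩
  | mem y hy => exact ⟨1, by simpa using hy⟩
  | inv_mem y hy => exact ⟨1, by simpa using hU.inv_mem y hy⟩
  | mul y z _ _ hy hz =>
    obtain ⟨m, hm⟩ := hy
    obtain ⟨n, hn⟩ := hz
    exact ⟨m + n, by rw [pow_add]; exact Set.mul_mem_mul hm hn⟩

theorem IsSymmGenSet.mem_pow_len {U : Set G} (hU : IsSymmGenSet U) (x : G) :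
    x ∈ U ^ len U x := Nat.sInf_mem (hU.exists_mem_pow x)

theorem len_one (U : Set G) : len U 1 = 0 :=
  Nat.le_zero.1 (Nat.sInf_le (by simp))

theorem IsSymmGenSet.len_mul_le {U : Set G} (hU : IsSymmGenSet U) (x y : G) :
    len U (x * y) ≤ len U x + len U y := by
  apply Nat.sInf_le
  change x * y ∈ U ^ (len U x + len U y)
  rw [pow_add]
  exact Set.mul_mem_mul (hU.mem_pow_len x) (hU.mem_pow_len y)

theorem IsSymmGenSet.len_inv {U : Set G} (hU : IsSymmGenSet U) (x : G) :
    len U x⁻¹ = len U x := by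
  have hUinv : U⁻¹ = U := by
    ext y
    exact ⟨fun h => by simpa using hU.inv_mem _ (Set.mem_inv.1 h),
      fun h => Set.mem_inv.2 (hU.inv_mem y h)⟩
  have key : ∀ (n : ℕ), x⁻¹ ∈ U ^ n ↔ x ∈ U ^ n := fun n => by
    rw [← Set.mem_inv, ← inv_pow, hUinv]
  simp only [len, key]

/-! ## The concrete weights -/

/-- The polynomial weight `ω_β(x) = (1 + τ(x))^β`. -/
noncomputable def polyWeight {U : Set G} (hU : IsSymmGenSet U) {β : ℝ} (hβ : 0 < β) :
    Weight G where
  toFun x := (1 + (len U x : ℝ)) ^ β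
  nonneg x := by positivity
  map_one := by simp [len_one]
  map_inv x := by rw [hU.len_inv]
  map_mul_le x y := by
    rw [← Real.mul_rpow (by positivity) (by positivity)]
    apply Real.rpow_le_rpow (by positivity) _ hβ.le
    have h : (len U (x * y) : ℝ) ≤ len U x + len U y := by exact_mod_cast hU.len_mul_le x y
    have h2 : (0 : ℝ) ≤ (len U x : ℝ) * len U y := by positivity
    nlinarith

/-- The subexponential weight `σ_{α,C}(x) = exp (C τ(x)^α)`, `0 < α < 1`, `C > 0`. -/
noncomputable def subexpWeight {U : Set G} (hU : IsSymmGenSet U) {α C : ℝ} (hα0 : 0 < α)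
    (hα1 : α < 1) (hC : 0 < C) : Weight G where
  toFun x := Real.exp (C * (len U x : ℝ) ^ α)
  nonneg x := by positivity
  map_one := by simp [len_one, Real.zero_rpow hα0.ne']
  map_inv x := by rw [hU.len_inv]
  map_mul_le x y := by
    rw [← Real.exp_add, ← mul_add]
    apply Real.exp_le_exp.2
    apply mul_le_mul_of_nonneg_left _ hC.le
    have h : (len U (x * y) : ℝ) ≤ len U x + len U y := by exact_mod_cast hU.len_mul_le x y
    exact (Real.rpow_le_rpow (by positivity) h hα0.le).trans
      (Real.rpow_add_le_add_rpow (by positivity) (by positivity) hα0.le hα1.le)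

/-- The function `1 + ∑ᵢ nᵢ 1_{G_{i+1} \ G_i}`. -/
noncomputable def stepFun (H : ℕ → Subgroup G) (n : ℕ → ℝ) (x : G) : ℝ :=
  1 + ∑' i, n i * ((H (i + 1) : Set G) \ (H i : Set G)).indicator 1 x

theorem stepFun_of_mem_zero {H : ℕ → Subgroup G} (hH : Monotone H) (n : ℕ → ℝ) {x : G}
    (hx : x ∈ H 0) : stepFun H n x = 1 := by
  have : ∀ i, n i * ((H (i + 1) : Set G) \ (H i : Set G)).indicator 1 x = 0 := fun i => by
    rw [Set.indicator_of_notMem, mul_zero]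
    exact fun h => h.2 (hH (Nat.zero_le i) hx)
  simp [stepFun, this]

theorem stepFun_of_mem_sdiff {H : ℕ → Subgroup G} (hH : Monotone H) (n : ℕ → ℝ) {x : G} {j : ℕ}
    (hx : x ∈ H (j + 1)) (hx' : x ∉ H j) : stepFun H n x = 1 + n j := by
  rw [stepFun, tsum_eq_single j]
  · rw [Set.indicator_of_mem (show x ∈ (H (j + 1) : Set G) \ (H j : Set G) from ⟨hx, hx'⟩)]
    simp
  · intro i hij
    rw [Set.indicator_of_notMem, mul_zero]
    rintro ⟨h1, h2⟩
    rcases lt_or_gt_of_ne hij with h | h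
    · exact hx' (hH (Nat.succ_le_of_lt h) h1)
    · exact h2 (hH (Nat.succ_le_of_lt h) hx)

theorem stepFun_cases {H : ℕ → Subgroup G} (hcov : ∀ x, ∃ i, x ∈ H i) (x : G) :
    x ∈ H 0 ∨ ∃ j, x ∈ H (j + 1) ∧ x ∉ H j := by
  classical
  rcases Nat.eq_zero_or_pos (Nat.find (hcov x)) with h | h
  · left
    rw [← h]
    exact Nat.find_spec (hcov x)
  · right
    refine ⟨Nat.find (hcov x) - 1, ?_, Nat.find_min (hcov x) (by omega)⟩
    rw [Nat.sub_add_cancel h]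
    exact Nat.find_spec (hcov x)

theorem one_le_stepFun {H : ℕ → Subgroup G} (hH : Monotone H) (hcov : ∀ x, ∃ i, x ∈ H i)
    {n : ℕ → ℝ} (hn1 : ∀ i, 1 ≤ n i) (x : G) : 1 ≤ stepFun H n x := by
  rcases stepFun_cases hcov x with h | ⟨j, h, h'⟩
  · rw [stepFun_of_mem_zero hH n h]
  · rw [stepFun_of_mem_sdiff hH n h h']
    linarith [hn1 j]

theorem stepFun_le_of_mem {H : ℕ → Subgroup G} (hH : Monotone H) (hcov : ∀ x, ∃ i, x ∈ H i)
    {n : ℕ → ℝ} (hn : Monotone n) (hn1 : ∀ i, 1 ≤ n i) {x : G} {j : ℕ} (hx : x ∈ H (j + 1)) :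
    stepFun H n x ≤ 1 + n j := by
  rcases stepFun_cases hcov x with h | ⟨i, h, h'⟩
  · rw [stepFun_of_mem_zero hH n h]
    linarith [hn1 j]
  · rw [stepFun_of_mem_sdiff hH n h h']
    have hij : i ≤ j := by
      by_contra hlt
      exact h' (hH (by omega) hx)
    linarith [hn hij]

theorem stepFun_mul_le {H : ℕ → Subgroup G} (hH : Monotone H) (hcov : ∀ x, ∃ i, x ∈ H i)
    {n : ℕ → ℝ} (hn : Monotone n) (hn1 : ∀ i, 1 ≤ n i) (x y : G) :
    stepFun H n (x * y) ≤ max (stepFun H n x) (stepFun H n y) := by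
  rcases stepFun_cases hcov x with hx | ⟨i, hx, hx'⟩
  · rcases stepFun_cases hcov y with hy | ⟨j, hy, hy'⟩
    · rw [stepFun_of_mem_zero hH n (mul_mem hx hy), stepFun_of_mem_zero hH n hx]
      exact le_max_left _ _
    · refine le_max_of_le_right ?_
      rw [stepFun_of_mem_sdiff hH n hy hy']
      exact stepFun_le_of_mem hH hcov hn hn1 (mul_mem (hH (Nat.zero_le _) hx) hy)
  · rcases stepFun_cases hcov y with hy | ⟨j, hy, hy'⟩
    · refine le_max_of_le_left ?_
      rw [stepFun_of_mem_sdiff hH n hx hx']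
      exact stepFun_le_of_mem hH hcov hn hn1 (mul_mem hx (hH (Nat.zero_le _) hy))
    · rcases le_total i j with hij | hij
      · refine le_max_of_le_right ?_
        rw [stepFun_of_mem_sdiff hH n hy hy']
        exact stepFun_le_of_mem hH hcov hn hn1 (mul_mem (hH (by omega) hx) hy)
      · refine le_max_of_le_left ?_
        rw [stepFun_of_mem_sdiff hH n hx hx']
        exact stepFun_le_of_mem hH hcov hn hn1 (mul_mem hx (hH (by omega) hy))

/-- The step weight `ω = 1 + ∑ᵢ nᵢ 1_{G_{i+1} \ G_i}` attached to an increasing sequence of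
subgroups `G_i` with union `G` and an increasing sequence `n_i` in `[1, ∞)`. -/
noncomputable def stepWeight {H : ℕ → Subgroup G} (hH : Monotone H) (hcov : ∀ x, ∃ i, x ∈ H i)
    {n : ℕ → ℝ} (hn : Monotone n) (hn1 : ∀ i, 1 ≤ n i) : Weight G where
  toFun := stepFun H n
  nonneg x := zero_le_one.trans (one_le_stepFun hH hcov hn1 x)
  map_one := stepFun_of_mem_zero hH n (one_mem _)
  map_inv x := by
    have h : ∀ i, x⁻¹ ∈ (H (i + 1) : Set G) \ (H i : Set G) ↔
        x ∈ (H (i + 1) : Set G) \ (H i : Set G) := fun i => by simp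
    have h' : ∀ i, ((H (i + 1) : Set G) \ (H i : Set G)).indicator (1 : G → ℝ) x⁻¹ =
        ((H (i + 1) : Set G) \ (H i : Set G)).indicator 1 x := fun i => by
      by_cases hx : x ∈ (H (i + 1) : Set G) \ (H i : Set G)
      · rw [Set.indicator_of_mem hx, Set.indicator_of_mem ((h i).2 hx)]
        rfl
      · rw [Set.indicator_of_notMem hx, Set.indicator_of_notMem (fun hh => hx ((h i).1 hh))]
    simp only [stepFun, h']
  map_mul_le x y := by
    have hx := one_le_stepFun hH hcov hn1 x
    have hy := one_le_stepFun hH hcov hn1 y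
    refine (stepFun_mul_le hH hcov hn hn1 x y).trans (max_le ?_ ?_) <;> nlinarith

end WeightedConv

/-! The inclusion into `C*_r(G)` satisfies a differential norm inequality `‖a²‖_A ≤ C ‖a‖_A^(1+θ)
‖a‖_B^(1-θ)` for some `0 < θ < 1`, and such an inequality forces norm-controlled inversion.

Inversion: scale so that `c = 1 - M⁻¹ a* a` has operator norm at most `ρ < 1`, with `ρ` depending
only on bounds for `‖a‖_A` and `‖a⁻¹‖_B`. In `A` the element `c` may be large, but repeated squaring
bounds `‖c^(2^k)‖_A` by a constant times `ρ^(2^k) W^((1+θ)^k)`. Since `2^k` beats `(1+θ)^k`, some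
power `N = 2^k`, again controlled, is small in `A`. Then `(1 - c)⁻¹ = (1 - c^N)⁻¹ ∑_{i<N} c^i` has
controlled norm, and `a⁻¹ = (1 - c)⁻¹ M⁻¹ a*`. This is `IsImageLE.pow_two_pow` and
`exists_isImageLE_inverse`.

The inequality: suppose `ω(xy) ≤ C (ω(x) ω(y)^γ + ω(x)^γ ω(y))`. Young's inequality gives `‖f *
f‖_{p,ω} ≤ 4C ‖f‖_{p,ω} ‖f ω^γ‖₁`. Hölder with three factors bounds `‖f ω^γ‖₁` by `‖f‖₂^(1-θ)
‖f‖_{p,ω}^θ` times a power of `∑ ω^(-s)`, and `‖f‖₂ ≤ ‖λ(f)‖` because `λ(f) δ_e = f`. A suitable `θ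
< 1` exists as soon as `∑ ω^(-s) < ∞` for some `s > 0` with `s (1 - 1/p) < 1 - γ`. This is
`admitsNormControlledInversion_of_weight`; the four cases verify its hypotheses, with `γ = 0` for
step and polynomial weights and `γ = α` for subexponential ones. -/

namespace WeightedConv

/-! ### Quantitative algebra in a Banach subalgebra, and iteration of the differential norm
inequality -/

section ImageLE

variable {A B : Type*} [NormedAddCommGroup A] [NormedSpace ℂ A] [NormedRing B] [NormedAlgebra ℂ B]

/-- `x` is the image under `ι` of an element of norm at most `r`. -/
def IsImageLE (ι : A →L[ℂ] B) (r : ℝ) (x : B) : Prop := ∃ a, ι a = x ∧ ‖a‖ ≤ r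

variable {ι : A →L[ℂ] B} {r s K e : ℝ} {x y : B}

theorem IsImageLE.mono (h : IsImageLE ι r x) (hrs : r ≤ s) : IsImageLE ι s x := by
  obtain ⟨a, ha, har⟩ := h
  exact ⟨a, ha, har.trans hrs⟩

theorem IsImageLE.nonneg (h : IsImageLE ι r x) : 0 ≤ r := by
  obtain ⟨a, -, har⟩ := h
  exact (norm_nonneg a).trans har

theorem IsImageLE.zero (ι : A →L[ℂ] B) : IsImageLE ι 0 0 := ⟨0, map_zero ι, by simp⟩

theorem IsImageLE.add (hx : IsImageLE ι r x) (hy : IsImageLE ι s y) :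
    IsImageLE ι (r + s) (x + y) := by
  obtain ⟨a, rfl, ha⟩ := hx
  obtain ⟨b, rfl, hb⟩ := hy
  exact ⟨a + b, map_add ι a b, (norm_add_le a b).trans (add_le_add ha hb)⟩

theorem IsImageLE.smul (hx : IsImageLE ι r x) (c : ℂ) : IsImageLE ι (‖c‖ * r) (c • x) := by
  obtain ⟨a, rfl, ha⟩ := hx
  exact ⟨c • a, map_smul ι c a, by rw [norm_smul]; gcongr⟩

theorem IsImageLE.mul (hK0 : 0 ≤ K) (hmul : ∀ a b : A, ∃ c : A, ι c = ι a * ι b)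
    (hK : ∀ a b c : A, ι c = ι a * ι b → ‖c‖ ≤ K * ‖a‖ * ‖b‖)
    (hx : IsImageLE ι r x) (hy : IsImageLE ι s y) : IsImageLE ι (K * r * s) (x * y) := by
  have hr := hx.nonneg
  obtain ⟨a, rfl, ha⟩ := hx
  obtain ⟨b, rfl, hb⟩ := hy
  obtain ⟨c, hc⟩ := hmul a b
  exact ⟨c, hc, (hK a b c hc).trans (by gcongr)⟩

theorem IsImageLE.pow (hK0 : 0 ≤ K) (hmul : ∀ a b : A, ∃ c : A, ι c = ι a * ι b)
    (hK : ∀ a b c : A, ι c = ι a * ι b → ‖c‖ ≤ K * ‖a‖ * ‖b‖) (hx : IsImageLE ι r x)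
    (he : IsImageLE ι e 1) (n : ℕ) : IsImageLE ι ((K * r) ^ n * e) (x ^ n) := by
  induction n with
  | zero => simpa using he
  | succ n ih =>
    rw [pow_succ', pow_succ', mul_assoc]
    exact hx.mul hK0 hmul hK ih

theorem IsImageLE.geom_sum (hK0 : 0 ≤ K) (hmul : ∀ a b : A, ∃ c : A, ι c = ι a * ι b)
    (hK : ∀ a b c : A, ι c = ι a * ι b → ‖c‖ ≤ K * ‖a‖ * ‖b‖) (hx : IsImageLE ι r x)
    (he : IsImageLE ι e 1) (n : ℕ) :
    IsImageLE ι (∑ i ∈ Finset.range n, (K * r) ^ i * e) (∑ i ∈ Finset.range n, x ^ i) := by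
  induction n with
  | zero => simpa using IsImageLE.zero ι
  | succ n ih =>
    rw [Finset.sum_range_succ, Finset.sum_range_succ]
    exact ih.add (hx.pow hK0 hmul hK he n)

/-- The Neumann series in `A`, for an element that is small in the norm of `A`. -/
theorem IsImageLE.exists_mul_one_sub_eq_one [CompleteSpace A] (hK0 : 0 ≤ K)
    (hmul : ∀ a b : A, ∃ c : A, ι c = ι a * ι b)
    (hK : ∀ a b c : A, ι c = ι a * ι b → ‖c‖ ≤ K * ‖a‖ * ‖b‖) (hx : IsImageLE ι r x)
    (he : IsImageLE ι e 1) (hr : K * r ≤ 1 / 2) :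
    ∃ y : B, y * (1 - x) = 1 ∧ IsImageLE ι (2 * e) y := by
  choose a ha hna using fun n => hx.pow hK0 hmul hK he n
  have hr0 := hx.nonneg
  have he0 := he.nonneg
  have hbound : ∀ n, ‖a n‖ ≤ (1 / 2 : ℝ) ^ n * e := fun n => (hna n).trans (by gcongr)
  have hs : HasSum (fun n : ℕ => (1 / 2 : ℝ) ^ n * e) (2 * e) := hasSum_geometric_two.mul_right e
  have hsum : Summable a := Summable.of_norm_bounded hs.summable hbound
  have hι : HasSum (fun n => x ^ n) (ι (∑' n, a n)) := by
    have := hsum.hasSum.mapL ι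
    simpa only [ha] using this
  refine ⟨ι (∑' n, a n), ?_, ∑' n, a n, rfl, ?_⟩
  · rw [← hι.tsum_eq]
    exact hι.summable.tsum_pow_mul_one_sub
  · exact tsum_of_norm_bounded hs hbound

/-- Let `N_k` bound the `A`-norm of `x^(2^k)` and normalise `q_k = D N_k / ρ^(2^k)`. The
differential inequality then reads `q_(k+1) ≤ q_k^(1+θ)`, because `2 - (1-θ) = 1+θ`; iterating from
`q_0 = D r / ρ` gives the bound. -/
theorem IsImageLE.pow_two_pow {D θ ρ : ℝ} (hD : 0 < D) (hθ : 0 < θ) (hρ : 0 < ρ)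
    (hmul : ∀ a b : A, ∃ c : A, ι c = ι a * ι b)
    (hdiff : ∀ a c : A, ι c = ι a * ι a →
      ‖c‖ ≤ D ^ θ * ‖a‖ ^ (1 + θ) * ‖ι a‖ ^ (1 - θ)) (hθ1 : θ < 1)
    (hx : IsImageLE ι r x) (hxρ : ‖x‖ ≤ ρ) (k : ℕ) :
    IsImageLE ι (D⁻¹ * ρ ^ (2 ^ k) * (D * r / ρ) ^ ((1 + θ) ^ k)) (x ^ (2 ^ k)) := by
  have hr0 := hx.nonneg
  induction k with
  | zero =>
    convert hx using 1
    · simp; field_simp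
    · simp
  | succ k ih =>
    set R := D⁻¹ * ρ ^ (2 ^ k) * (D * r / ρ) ^ ((1 + θ) ^ k) with hR
    have hpow : ‖x ^ 2 ^ k‖ ≤ ρ ^ 2 ^ k :=
      (norm_pow_le' x (by positivity)).trans (by gcongr)
    have hW : 0 ≤ D * r / ρ := by positivity
    have key : D ^ θ * R ^ (1 + θ) * (ρ ^ 2 ^ k) ^ (1 - θ) =
        D⁻¹ * ρ ^ (2 ^ (k + 1)) * (D * r / ρ) ^ ((1 + θ) ^ (k + 1)) := by
      rw [hR, Real.mul_rpow (by positivity) (by positivity),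
        Real.mul_rpow (by positivity) (by positivity), ← Real.rpow_mul hW, ← pow_succ]
      have h1 : D ^ θ * D⁻¹ ^ (1 + θ) = D⁻¹ := by
        rw [Real.inv_rpow hD.le, Real.rpow_add hD, Real.rpow_one]
        have := (Real.rpow_pos_of_pos hD θ).ne'
        field_simp
      have hz : 0 < ρ ^ 2 ^ k := by positivity
      have h2 : (ρ ^ 2 ^ k) ^ (1 + θ) * (ρ ^ 2 ^ k) ^ (1 - θ) = ρ ^ 2 ^ (k + 1) := by
        rw [← Real.rpow_add hz, pow_succ 2 k, pow_mul ρ]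
        norm_num
      calc _ = D ^ θ * D⁻¹ ^ (1 + θ) * ((ρ ^ 2 ^ k) ^ (1 + θ) * (ρ ^ 2 ^ k) ^ (1 - θ)) *
            (D * r / ρ) ^ ((1 + θ) ^ (k + 1)) := by
            rw [pow_succ (1 + θ)]; ring
        _ = _ := by rw [h1, h2]
    rw [← key]
    obtain ⟨a, ha, har⟩ := ih
    obtain ⟨c, hc⟩ := hmul a a
    refine ⟨c, by rw [hc, ha, ← pow_add, pow_succ 2 k, mul_two], (hdiff a c hc).trans ?_⟩
    rw [ha]
    gcongr

end ImageLE

/-- The logarithm of the left side is `2^k (((1+θ)/2)^k log W + log ρ)`. The bracket tends to `log ρ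
< 0`, so the product tends to `-∞`. -/
theorem exists_pow_mul_rpow_le {ρ θ W ε : ℝ} (hρ : 0 < ρ) (hρ1 : ρ < 1) (hW : 0 < W)
    (hθ : 0 < θ) (hθ1 : θ < 1) (hε : 0 < ε) :
    ∃ k : ℕ, ρ ^ (2 ^ k) * W ^ ((1 + θ) ^ k) ≤ ε := by
  have h1 : Filter.Tendsto (fun k : ℕ => ((1 + θ) / 2) ^ k * Real.log W + Real.log ρ)
      Filter.atTop (nhds (0 * Real.log W + Real.log ρ)) :=
    ((tendsto_pow_atTop_nhds_zero_of_lt_one (by positivity) (by linarith)).mul_const _).add_const _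
  rw [zero_mul, zero_add] at h1
  have h2 := (tendsto_pow_atTop_atTop_of_one_lt (one_lt_two (α := ℝ))).atTop_mul_neg
    (Real.log_neg hρ hρ1) h1
  obtain ⟨k, hk⟩ := (h2.eventually (Filter.eventually_le_atBot (Real.log ε))).exists
  refine ⟨k, ?_⟩
  rw [← Real.log_le_log_iff (by positivity) hε, Real.log_mul (by positivity) (by positivity),
    Real.log_pow, Real.log_rpow hW]
  refine le_trans (le_of_eq ?_) hk
  push_cast
  rw [div_pow]
  field_simp
  ring

/-! ### From the differential norm inequality to norm-controlled inversion -/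

section Hilbert

variable {H : Type*} [NormedAddCommGroup H] [InnerProductSpace ℂ H] [CompleteSpace H]

/-- If `a` is bounded below by `T⁻¹` and `‖a‖² ≤ M`, then `1 - M⁻¹ a* a` is a strict contraction. -/
theorem norm_one_sub_smul_star_mul_self_le (a : H →L[ℂ] H) {M T : ℝ} (hM : 0 < M) (hT : 0 < T)
    (haM : ‖a‖ ^ 2 ≤ M) (haT : ∀ ξ, ‖ξ‖ ≤ T * ‖a ξ‖) :
    ‖1 - ((M⁻¹ : ℝ) : ℂ) • (star a * a)‖ ≤ Real.sqrt (1 - 1 / (M * T ^ 2)) := by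
  refine ContinuousLinearMap.opNorm_le_bound _ (Real.sqrt_nonneg _) fun ξ => ?_
  have e1 : (1 - ((M⁻¹ : ℝ) : ℂ) • (star a * a)) ξ =
      ξ - ((M⁻¹ : ℝ) : ℂ) • (star a) (a ξ) := by simp
  have h1 : ‖(star a) (a ξ)‖ ^ 2 ≤ M * ‖a ξ‖ ^ 2 := by
    have := (star a).le_opNorm (a ξ)
    rw [norm_star] at this
    calc ‖(star a) (a ξ)‖ ^ 2 ≤ (‖a‖ * ‖a ξ‖) ^ 2 := by gcongr
      _ = ‖a‖ ^ 2 * ‖a ξ‖ ^ 2 := by ring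
      _ ≤ _ := by gcongr
  -- This is `⟨ξ, a* a ξ⟩ = ‖a ξ‖²`, the cross term in the expansion of `‖ξ - M⁻¹ a* a ξ‖²`. The
  -- quadratic term cancels at most half of the negative contribution, and the lower bound on `a`
  -- uses the rest.
  have h2 : RCLike.re (inner ℂ ξ (((M⁻¹ : ℝ) : ℂ) • (star a) (a ξ))) = M⁻¹ * ‖a ξ‖ ^ 2 := by
    rw [inner_smul_right, ContinuousLinearMap.star_eq_adjoint,
      ContinuousLinearMap.adjoint_inner_right, inner_self_eq_norm_sq_to_K, ← RCLike.ofReal_pow]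
    exact RCLike.re_ofReal_mul _ _ |>.trans (by rw [RCLike.ofReal_re]; rfl)
  have h3 : ‖ξ - ((M⁻¹ : ℝ) : ℂ) • (star a) (a ξ)‖ ^ 2 ≤ (1 - 1 / (M * T ^ 2)) * ‖ξ‖ ^ 2 := by
    rw [norm_sub_sq (𝕜 := ℂ), h2, norm_smul, mul_pow, Complex.norm_real, Real.norm_eq_abs, sq_abs]
    have h4 : M⁻¹ ^ 2 * ‖(star a) (a ξ)‖ ^ 2 ≤ M⁻¹ * ‖a ξ‖ ^ 2 := by
      calc _ ≤ M⁻¹ ^ 2 * (M * ‖a ξ‖ ^ 2) := by gcongr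
        _ = _ := by field_simp
    have h5 : 1 / (M * T ^ 2) * ‖ξ‖ ^ 2 ≤ M⁻¹ * ‖a ξ‖ ^ 2 := by
      calc _ ≤ 1 / (M * T ^ 2) * (T * ‖a ξ‖) ^ 2 := by gcongr; exact haT ξ
        _ = _ := by field_simp
    linarith
  rw [e1]
  calc _ = Real.sqrt (‖ξ - ((M⁻¹ : ℝ) : ℂ) • (star a) (a ξ)‖ ^ 2) :=
        (Real.sqrt_sq (norm_nonneg _)).symm
    _ ≤ Real.sqrt ((1 - 1 / (M * T ^ 2)) * ‖ξ‖ ^ 2) := Real.sqrt_le_sqrt h3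
    _ = _ := by rw [Real.sqrt_mul' _ (by positivity), Real.sqrt_sq (norm_nonneg _)]

variable {A : Type*} [NormedAddCommGroup A] [NormedSpace ℂ A] [CompleteSpace A]
  {S : StarSubalgebra ℂ (H →L[ℂ] H)} {ι : A →L[ℂ] S}

/-- The inverse is recovered as `(a* a)⁻¹ a*`, with `a* a` inverted by a Neumann series grouped into
blocks of length `2^k`. The exponent `k` and the bound `R` are fixed before `a` is chosen, so they
depend only on `s` and `t`. -/
theorem exists_isImageLE_inverse (hι : IsBanachSubalgebra ι)
    (hstar : ∀ a : A, IsImageLE ι ‖a‖ (star (ι a))) {C θ : ℝ} (hC : 0 < C) (hθ : 0 < θ)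
    (hθ1 : θ < 1)
    (hdiff : ∀ a c : A, ι c = ι a * ι a → ‖c‖ ≤ C * ‖a‖ ^ (1 + θ) * ‖ι a‖ ^ (1 - θ))
    (s t : ℝ) (hs : 0 ≤ s) (ht : 0 ≤ t) :
    ∃ R : ℝ, ∀ (a : A) (y : S), ‖a‖ ≤ s → ‖y‖ ≤ t → ι a * y = 1 → y * ι a = 1 →
      IsImageLE ι R y := by
  obtain ⟨-, ⟨e₀, he₀⟩, hmul, K₀, hK₀⟩ := hι
  set K := max K₀ 1 with hKdef
  have hK0 : 0 < K := lt_max_of_lt_right one_pos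
  have hK : ∀ a b c : A, ι c = ι a * ι b → ‖c‖ ≤ K * ‖a‖ * ‖b‖ := fun a b c h =>
    (hK₀ a b c h).trans (by gcongr; exact le_max_left _ _)
  have he : IsImageLE ι ‖e₀‖ 1 := ⟨e₀, he₀, le_rfl⟩
  -- `M` dominates `‖ι a‖²` and `T` dominates `‖y‖`. The added `2` and `1` give `M T² > 1`, hence `0
  -- < ρ < 1` even when `s` or `t` vanishes.
  set M := (‖ι‖ * s) ^ 2 + 2 with hM
  set T := t + 1 with hT
  set ρ := Real.sqrt (1 - 1 / (M * T ^ 2)) with hρdef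
  have hM0 : 0 < M := by positivity
  have hT0 : 0 < T := by positivity
  have hMT : 1 < M * T ^ 2 := by
    have h1 : 1 ≤ T ^ 2 := one_le_pow₀ (by rw [hT]; linarith)
    have h2 : 2 ≤ M := by rw [hM]; nlinarith [sq_nonneg (‖ι‖ * s)]
    nlinarith
  have hρ0 : 0 < ρ := Real.sqrt_pos.2 (by rw [sub_pos, div_lt_one (by positivity)]; exact hMT)
  have hρ1 : ρ < 1 := by
    rw [hρdef, Real.sqrt_lt' one_pos]
    have : 0 < 1 / (M * T ^ 2) := by positivity
    linarith
  -- Chosen so that `D^θ = C`, the form used in `IsImageLE.pow_two_pow`.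
  set D := C ^ (1 / θ) with hD
  have hD0 : 0 < D := Real.rpow_pos_of_pos hC _
  have hDθ : D ^ θ = C := by
    rw [hD, ← Real.rpow_mul hC.le, one_div_mul_cancel hθ.ne', Real.rpow_one]
  -- A bound for the `A`-norm of `c = 1 - M⁻¹ a* a`; the final `1` only makes it strictly positive.
  set r := ‖e₀‖ + ‖(-((M⁻¹ : ℝ) : ℂ))‖ * (K * s * s) + 1 with hr
  have hr0 : 0 < r := by positivity
  obtain ⟨k, hk⟩ := exists_pow_mul_rpow_le hρ0 hρ1 (W := D * r / ρ) (by positivity) hθ hθ1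
    (ε := D / (2 * K)) (by positivity)
  refine ⟨K * (K * (2 * ‖e₀‖) * (∑ i ∈ Finset.range (2 ^ k), (K * r) ^ i * ‖e₀‖)) *
    (‖((M⁻¹ : ℝ) : ℂ)‖ * s), fun a y has hyt hay hya => ?_⟩
  have hιa : IsImageLE ι s (ι a) := ⟨a, rfl, has⟩
  have hιa' : IsImageLE ι s (star (ι a)) := (hstar a).mono has
  set c : S := 1 + (-((M⁻¹ : ℝ) : ℂ)) • (star (ι a) * ι a) with hc
  have hcr : IsImageLE ι r c :=
    (he.add ((hιa'.mul hK0.le hmul hK hιa).smul _)).mono (by rw [hr]; linarith)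
  have hcρ : ‖c‖ ≤ ρ := by
    have := norm_one_sub_smul_star_mul_self_le (ι a : H →L[ℂ] H) hM0 hT0 (by
      have h1 : ‖(ι a : H →L[ℂ] H)‖ ≤ ‖ι‖ * s := (ι.le_opNorm a).trans (by gcongr)
      calc _ ≤ (‖ι‖ * s) ^ 2 := by gcongr
        _ ≤ M := by rw [hM]; linarith) (fun ξ => by
      have h1 : (y : H →L[ℂ] H) ((ι a : H →L[ℂ] H) ξ) = ξ := by
        have := congrArg (fun z : S => (z : H →L[ℂ] H) ξ) hya
        simpa using this
      have hyt' : ‖(y : H →L[ℂ] H)‖ ≤ t := hyt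
      calc ‖ξ‖ = ‖(y : H →L[ℂ] H) ((ι a : H →L[ℂ] H) ξ)‖ := by rw [h1]
        _ ≤ ‖(y : H →L[ℂ] H)‖ * ‖(ι a : H →L[ℂ] H) ξ‖ := ContinuousLinearMap.le_opNorm _ _
        _ ≤ T * _ := by gcongr; rw [hT]; linarith)
    refine le_trans (le_of_eq ?_) this
    change ‖(c : H →L[ℂ] H)‖ = _
    congr 1
    rw [hc]
    push_cast
    rw [neg_smul, ← sub_eq_add_neg]
    rfl
  have hcN := hcr.pow_two_pow hD0 hθ hρ0 hmul (by rw [hDθ]; exact hdiff) hθ1 hcρ k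
  obtain ⟨z, hz1, hz⟩ := hcN.exists_mul_one_sub_eq_one hK0.le hmul hK he (by
    calc K * (D⁻¹ * ρ ^ (2 ^ k) * (D * r / ρ) ^ ((1 + θ) ^ k))
        = K * D⁻¹ * (ρ ^ (2 ^ k) * (D * r / ρ) ^ ((1 + θ) ^ k)) := by ring
      _ ≤ K * D⁻¹ * (D / (2 * K)) := by gcongr
      _ = 1 / 2 := by field_simp)
  -- By telescoping, `z (∑ c^i) (1 - c) = z (1 - c^(2^k)) = 1`. The right side is therefore a left
  -- inverse of `ι a`, and it equals the two-sided inverse `y`.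
  have hy : y = z * (∑ i ∈ Finset.range (2 ^ k), c ^ i) * (((M⁻¹ : ℝ) : ℂ) • star (ι a)) := by
    have h1 : z * (∑ i ∈ Finset.range (2 ^ k), c ^ i) * (((M⁻¹ : ℝ) : ℂ) • star (ι a)) * ι a
        = 1 := by
      have h2 : ((M⁻¹ : ℝ) : ℂ) • star (ι a) * ι a = 1 - c := by
        rw [hc, neg_smul, smul_mul_assoc]
        abel
      rw [mul_assoc, h2, mul_assoc, geom_sum_mul_neg, hz1]
    calc y = 1 * y := (one_mul y).symm
      _ = _ := by rw [← h1, mul_assoc, hay, mul_one]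
  rw [hy]
  exact (hz.mul hK0.le hmul hK (hcr.geom_sum hK0.le hmul hK he _)).mul hK0.le hmul hK
    (hιa'.smul _)

theorem normControlledInversion_of_differential (hι : IsBanachSubalgebra ι)
    (hstar : ∀ a : A, IsImageLE ι ‖a‖ (star (ι a))) {C θ : ℝ} (hC : 0 < C) (hθ : 0 < θ)
    (hθ1 : θ < 1)
    (hdiff : ∀ a c : A, ι c = ι a * ι a → ‖c‖ ≤ C * ‖a‖ ^ (1 + θ) * ‖ι a‖ ^ (1 - θ)) :
    NormControlledInversion ι where
  isBanachSubalgebra := hι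
  inverseClosed a y h1 h2 := by
    obtain ⟨R, hR⟩ := exists_isImageLE_inverse hι hstar hC hθ hθ1 hdiff ‖a‖ ‖y‖
      (norm_nonneg _) (norm_nonneg _)
    obtain ⟨b, hb, -⟩ := hR a y le_rfl le_rfl h1 h2
    exact ⟨b, hb⟩
  normControl := by
    choose R hR using fun s t : ℝ≥0 => exists_isImageLE_inverse hι hstar hC hθ hθ1 hdiff s t
      s.2 t.2
    refine ⟨fun s t => (R s t).toNNReal, fun a b h1 h2 => ?_⟩
    obtain ⟨b', hb', hn⟩ := hR ‖a‖₊ ‖ι b‖₊ a (ι b) le_rfl le_rfl h1 h2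
    rw [hι.injective hb'] at hn
    exact NNReal.coe_le_coe.1 (by simpa using hn.trans (le_max_left _ 0))

end Hilbert

/-! ### Hölder, Young and interpolation inequalities for sums -/

section ENNReal

/-- Hölder's inequality for counting measure; with the top σ-algebra every function is measurable.
Zero exponents are allowed, which the interpolation needs at the endpoint `θ = 1`. -/
theorem tsum_prod_rpow_le {α κ : Type*} (s : Finset κ) (f : κ → α → ℝ≥0∞) {p : κ → ℝ}
    (hp : ∑ i ∈ s, p i = 1) (h2p : ∀ i ∈ s, 0 ≤ p i) :
    ∑' a, ∏ i ∈ s, f i a ^ p i ≤ ∏ i ∈ s, (∑' a, f i a) ^ p i := by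
  let : MeasurableSpace α := ⊤
  have := ENNReal.lintegral_prod_norm_pow_le (μ := MeasureTheory.Measure.count) s (f := f)
    (fun i _ => measurable_from_top.aemeasurable) hp h2p
  simpa only [MeasureTheory.lintegral_count] using this

/-- Hölder applied to the factorisation `a b = a^(1 - 1/P) (a b^P)^(1/P)`. -/
theorem tsum_mul_rpow_le {α : Type*} (a b : α → ℝ≥0∞) {P : ℝ} (hP : 1 ≤ P) :
    (∑' y, a y * b y) ^ P ≤ (∑' y, a y) ^ (P - 1) * ∑' y, a y * b y ^ P := by
  have hP0 : 0 < P := by linarith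
  have hP1 : 0 ≤ 1 - 1 / P := by rw [sub_nonneg, div_le_one hP0]; exact hP
  have h := tsum_prod_rpow_le Finset.univ ![a, fun y => a y * b y ^ P] (p := ![1 - 1 / P, 1 / P])
    (by simp) (by intro i _; fin_cases i; exacts [hP1, by simpa using hP0.le])
  simp only [Fin.prod_univ_two, Matrix.cons_val_zero, Matrix.cons_val_one] at h
  have e : ∀ y, a y ^ (1 - 1 / P) * (a y * b y ^ P) ^ (1 / P) = a y * b y := fun y => by
    rw [ENNReal.mul_rpow_of_nonneg _ _ (by positivity), ← mul_assoc,
      ← ENNReal.rpow_add_of_nonneg _ _ hP1 (by positivity), sub_add_cancel, ENNReal.rpow_one,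
      ← ENNReal.rpow_mul, mul_one_div_cancel hP0.ne', ENNReal.rpow_one]
  simp only [e] at h
  calc _ ≤ ((∑' y, a y) ^ (1 - 1 / P) * (∑' y, a y * b y ^ P) ^ (1 / P)) ^ P := by gcongr
    _ = _ := by
      rw [ENNReal.mul_rpow_of_nonneg _ _ hP0.le, ← ENNReal.rpow_mul, ← ENNReal.rpow_mul,
        one_div_mul_cancel hP0.ne', ENNReal.rpow_one, sub_mul, one_mul,
        one_div_mul_cancel hP0.ne']

/-- The preceding inequality is applied for each `x` and the order of summation exchanged. Stated
for a general kernel, it yields both one-sided Young inequalities by translation invariance. -/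
theorem tsum_tsum_mul_rpow_le {α β : Type*} (a : β → ℝ≥0∞) (b : α → β → ℝ≥0∞) {M : ℝ≥0∞} {P : ℝ}
    (hP : 1 ≤ P) (hM : ∀ y, ∑' x, b x y ^ P ≤ M) :
    ∑' x, (∑' y, a y * b x y) ^ P ≤ (∑' y, a y) ^ P * M := by
  calc _ ≤ ∑' x, (∑' y, a y) ^ (P - 1) * ∑' y, a y * b x y ^ P :=
        ENNReal.tsum_le_tsum fun x => tsum_mul_rpow_le a (b x) hP
    _ = (∑' y, a y) ^ (P - 1) * ∑' y, a y * ∑' x, b x y ^ P := by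
        rw [ENNReal.tsum_mul_left, ENNReal.tsum_comm]
        simp only [ENNReal.tsum_mul_left]
    _ ≤ (∑' y, a y) ^ (P - 1) * ∑' y, a y * M := by gcongr; exact hM _
    _ = _ := by
        rw [ENNReal.tsum_mul_right, ← mul_assoc]
        congr 1
        nth_rw 2 [← ENNReal.rpow_one (∑' y, a y)]
        rw [← ENNReal.rpow_add_of_nonneg _ _ (by linarith) one_pos.le, sub_add_cancel]

variable {G : Type u} [Group G]

theorem tsum_conv_rpow_le_left (F H : G → ℝ≥0∞) {P : ℝ} (hP : 1 ≤ P) :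
    ∑' x, (∑' y, F y * H (y⁻¹ * x)) ^ P ≤ (∑' y, F y) ^ P * ∑' x, H x ^ P :=
  tsum_tsum_mul_rpow_le F (fun x y => H (y⁻¹ * x)) hP fun y =>
    ((Equiv.mulLeft y⁻¹).tsum_eq fun x => H x ^ P).le

theorem tsum_conv_rpow_le_right (F H : G → ℝ≥0∞) {P : ℝ} (hP : 1 ≤ P) :
    ∑' x, (∑' y, F y * H (y⁻¹ * x)) ^ P ≤ (∑' x, F x ^ P) * (∑' y, H y) ^ P := by
  -- The substitution `y = x z⁻¹` moves the translation from `H` to `F`.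
  have h : ∀ x, ∑' y, F y * H (y⁻¹ * x) = ∑' z, H z * F (x * z⁻¹) := fun x => by
    rw [← ((Equiv.inv G).trans (Equiv.mulLeft x)).tsum_eq]
    simp [mul_comm]
  simp only [h]
  rw [mul_comm]
  exact tsum_tsum_mul_rpow_le H (fun x z => F (x * z⁻¹)) hP fun z =>
    ((Equiv.mulRight z⁻¹).tsum_eq fun x => F x ^ P).le

/-- Weighted Young inequality for a weight with
`w(xy) ≤ C (w(x) w(y)^γ + w(x)^γ w(y))`. -/
theorem tsum_conv_mul_weight_rpow_le (F H k w : G → ℝ≥0∞) {C : ℝ≥0∞} {γ P : ℝ} (hP : 1 ≤ P)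
    (hw : ∀ x y, w (x * y) ≤ C * (w x * w y ^ γ + w x ^ γ * w y))
    (hk : ∀ x, k x ≤ ∑' y, F y * H (y⁻¹ * x)) :
    ∑' x, (k x * w x) ^ P ≤ C ^ P * 2 ^ (P - 1) *
      ((∑' x, (F x * w x) ^ P) * (∑' x, H x * w x ^ γ) ^ P +
        (∑' x, F x * w x ^ γ) ^ P * ∑' x, (H x * w x) ^ P) := by
  have hP0 : 0 ≤ P := by linarith
  set A := fun x => ∑' y, (F y * w y) * (H (y⁻¹ * x) * w (y⁻¹ * x) ^ γ)
  set B := fun x => ∑' y, (F y * w y ^ γ) * (H (y⁻¹ * x) * w (y⁻¹ * x))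
  have h1 : ∀ x, k x * w x ≤ C * (A x + B x) := fun x => by
    calc k x * w x ≤ (∑' y, F y * H (y⁻¹ * x)) * w x := by gcongr; exact hk x
      _ = ∑' y, F y * H (y⁻¹ * x) * w x := ENNReal.tsum_mul_right.symm
      _ ≤ ∑' y, C * ((F y * w y) * (H (y⁻¹ * x) * w (y⁻¹ * x) ^ γ) +
            (F y * w y ^ γ) * (H (y⁻¹ * x) * w (y⁻¹ * x))) := by
          refine ENNReal.tsum_le_tsum fun y => ?_
          have := hw y (y⁻¹ * x)
          rw [mul_inv_cancel_left] at this
          calc _ ≤ F y * H (y⁻¹ * x) *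
                (C * (w y * w (y⁻¹ * x) ^ γ + w y ^ γ * w (y⁻¹ * x))) := by gcongr
            _ = _ := by ring
      _ = C * (A x + B x) := by rw [ENNReal.tsum_mul_left, ENNReal.tsum_add]
  calc _ ≤ ∑' x, C ^ P * (2 ^ (P - 1) * (A x ^ P + B x ^ P)) := by
        refine ENNReal.tsum_le_tsum fun x => ?_
        calc _ ≤ (C * (A x + B x)) ^ P := ENNReal.rpow_le_rpow (h1 x) hP0
          _ = C ^ P * (A x + B x) ^ P := ENNReal.mul_rpow_of_nonneg _ _ hP0
          _ ≤ _ := by gcongr; exact ENNReal.rpow_add_le_mul_rpow_add_rpow _ _ hP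
    _ = C ^ P * 2 ^ (P - 1) * (∑' x, A x ^ P + ∑' x, B x ^ P) := by
        rw [ENNReal.tsum_mul_left, ENNReal.tsum_mul_left, ENNReal.tsum_add, mul_assoc]
    _ ≤ _ := by
        gcongr
        · exact tsum_conv_rpow_le_right (fun x => F x * w x) (fun x => H x * w x ^ γ) hP
        · exact tsum_conv_rpow_le_left (fun x => F x * w x ^ γ) (fun x => H x * w x) hP

/-- Interpolation of a weighted `ℓ¹`-norm between `ℓ²` and a weighted `ℓ^P`-norm. -/
theorem tsum_mul_rpow_le_interpolate {α : Type*} (F w : α → ℝ≥0∞) {γ θ s P : ℝ} (hP : 1 ≤ P)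
    (hθ0 : 0 ≤ θ) (hθ1 : θ ≤ 1) (hw1 : ∀ x, 1 ≤ w x) (hwt : ∀ x, w x ≠ ⊤)
    (hs : s * ((1 + θ) / 2 - θ / P) ≤ θ - γ) :
    ∑' x, F x * w x ^ γ ≤ (∑' x, F x ^ (2 : ℝ)) ^ ((1 - θ) / 2) *
      (∑' x, (F x * w x) ^ P) ^ (θ / P) * (∑' x, w x ^ (-s)) ^ ((1 + θ) / 2 - θ / P) := by
  have hP0 : 0 < P := by linarith
  have h3 : 0 ≤ (1 + θ) / 2 - θ / P := by
    have : θ / P ≤ θ := div_le_self hθ0 hP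
    linarith
  -- The three exponents sum to `1`. In the product of the factors `F` appears to the power `(1-θ) +
  -- θ = 1`, and `w` to the power `θ - s ((1+θ)/2 - θ/P)`, which is at least `γ` by `hs`.
  have h := tsum_prod_rpow_le Finset.univ
    ![fun x => F x ^ (2 : ℝ), fun x => (F x * w x) ^ P, fun x => w x ^ (-s)]
    (p := ![(1 - θ) / 2, θ / P, (1 + θ) / 2 - θ / P])
    (by simp [Fin.sum_univ_three]; ring)
    (by
      intro i _
      fin_cases i
      exacts [div_nonneg (sub_nonneg.2 hθ1) zero_le_two, by simpa using div_nonneg hθ0 hP0.le, h3])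
  simp only [Fin.prod_univ_three, Matrix.cons_val] at h
  refine le_trans (ENNReal.tsum_le_tsum fun x => ?_) h
  have hw0 : w x ≠ 0 := (zero_lt_one.trans_le (hw1 x)).ne'
  rw [← ENNReal.rpow_mul, ← ENNReal.rpow_mul, ← ENNReal.rpow_mul,
    show (2 : ℝ) * ((1 - θ) / 2) = 1 - θ by ring, mul_div_cancel₀ _ hP0.ne',
    ENNReal.mul_rpow_of_nonneg _ _ hθ0, ← mul_assoc,
    ← ENNReal.rpow_add_of_nonneg _ _ (by linarith) hθ0, sub_add_cancel, ENNReal.rpow_one,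
    mul_assoc, ← ENNReal.rpow_add _ _ hw0 (hwt x)]
  gcongr
  · exact hw1 x
  · linarith

end ENNReal

/-! ### Convolution operators of absolutely summable functions -/

section RegularRepresentation

variable {G : Type u} [Group G]

theorem norm_leftRegular_le (g : G) : ‖leftRegular g‖ ≤ 1 :=
  LinearMap.mkContinuous_norm_le _ zero_le_one _

theorem leftRegular_mul (g h : G) : leftRegular (g * h) = leftRegular g * leftRegular h := by
  ext ξ x
  change ξ ((g * h)⁻¹ * x) = ξ (h⁻¹ * (g⁻¹ * x))
  rw [mul_inv_rev, mul_assoc]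

theorem leftRegular_one : leftRegular (1 : G) = 1 := by
  ext ξ x
  change ξ (1⁻¹ * x) = ξ x
  simp

theorem star_leftRegular (g : G) : star (leftRegular g) = leftRegular g⁻¹ := by
  symm
  rw [ContinuousLinearMap.star_eq_adjoint, ContinuousLinearMap.eq_adjoint_iff]
  intro ξ η
  rw [lp.inner_eq_tsum, lp.inner_eq_tsum, ← (Equiv.mulLeft g⁻¹).tsum_eq]
  simp [leftRegular_apply]

/-- The operator `∑ f(g) λ(g)` of convolution by an absolutely summable function `f`. -/
noncomputable def regRep (f : G → ℂ) : L2 G →L[ℂ] L2 G := ∑' g, f g • leftRegular g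

variable {f h : G → ℂ}

theorem norm_smul_leftRegular_le (f : G → ℂ) (g : G) : ‖f g • leftRegular g‖ ≤ ‖f g‖ := by
  rw [norm_smul]
  exact mul_le_of_le_one_right (norm_nonneg _) (norm_leftRegular_le g)

theorem summable_norm_smul_leftRegular (hf : Summable fun g => ‖f g‖) :
    Summable fun g => ‖f g • leftRegular g‖ :=
  Summable.of_nonneg_of_le (fun _ => norm_nonneg _) (norm_smul_leftRegular_le f) hf

theorem hasSum_regRep (hf : Summable fun g => ‖f g‖) :
    HasSum (fun g => f g • leftRegular g) (regRep f) :=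
  (summable_norm_smul_leftRegular hf).of_norm.hasSum

theorem norm_regRep_le (hf : Summable fun g => ‖f g‖) : ‖regRep f‖ ≤ ∑' g, ‖f g‖ :=
  tsum_of_norm_bounded hf.hasSum (norm_smul_leftRegular_le f)

theorem regRep_mem (hf : Summable fun g => ‖f g‖) : regRep f ∈ reducedCStar G := by
  have hcl : IsClosed (reducedCStar G : Set (L2 G →L[ℂ] L2 G)) :=
    StarSubalgebra.isClosed_topologicalClosure _
  refine hcl.mem_of_tendsto (hasSum_regRep hf) (Filter.Eventually.of_forall fun s => ?_)
  refine sum_mem fun g _ => SMulMemClass.smul_mem _ ?_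
  exact StarSubalgebra.le_topologicalClosure _ (StarAlgebra.subset_adjoin ℂ _ ⟨g, rfl⟩)

theorem hasSum_regRep_apply (hf : Summable fun g => ‖f g‖) (ξ : L2 G) (x : G) :
    HasSum (fun y => f y * ξ (y⁻¹ * x)) (regRep f ξ x) := by
  have h1 : HasSum (fun g => f g • leftRegular g ξ) (regRep f ξ) :=
    (hasSum_regRep hf).mapL (ContinuousLinearMap.apply ℂ (L2 G) ξ)
  exact h1.mapL (lp.evalCLM ℂ (fun _ : G => ℂ) 2 x)

theorem regRep_apply_single [DecidableEq G] (hf : Summable fun g => ‖f g‖) (x : G) :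
    regRep f (lp.single 2 1 1) x = f x := by
  refine (hasSum_regRep_apply hf _ x).unique ?_
  convert hasSum_ite_eq x (f x) using 2 with y
  by_cases hy : y = x
  · simp [hy]
  · have : y⁻¹ * x ≠ 1 := fun hh => hy (inv_mul_eq_one.1 hh)
    simp [hy, lp.single_apply, Pi.single_eq_of_ne this]

/-- Since `regRep f` sends the unit vector `δ_e` to `f`, its operator norm dominates `‖f‖₂`. This is
how the norm of `C*_r(G)` enters the interpolation. -/
theorem tsum_norm_sq_le_norm_regRep (hf : Summable fun g => ‖f g‖) :
    ∑' x, ‖f x‖ₑ ^ (2 : ℝ) ≤ ENNReal.ofReal ‖regRep f‖ ^ (2 : ℝ) := by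
  classical
  have h2 : (0 : ℝ) < (2 : ℝ≥0∞).toReal := by norm_num
  set ξ : L2 G := regRep f (lp.single 2 1 1) with hξ
  have hξf : ∀ x, ξ x = f x := regRep_apply_single hf
  have h1 : ‖ξ‖ ≤ ‖regRep f‖ := by
    refine ((regRep f).le_opNorm _).trans ?_
    rw [lp.norm_single (by norm_num)]
    simp
  have h3 : Summable fun x => ‖ξ x‖ ^ (2 : ℝ≥0∞).toReal := (memℓp_gen_iff h2).1 (lp.memℓp ξ)
  have h4 := lp.norm_rpow_eq_tsum h2 ξ
  simp only [ENNReal.toReal_ofNat] at h3 h4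
  calc ∑' x, ‖f x‖ₑ ^ (2 : ℝ) = ∑' x, ENNReal.ofReal (‖ξ x‖ ^ (2 : ℝ)) := by
        congr 1
        ext x
        rw [← hξf x, ← ENNReal.ofReal_rpow_of_nonneg (norm_nonneg _) zero_le_two,
          ofReal_norm]
    _ = ENNReal.ofReal (‖ξ‖ ^ (2 : ℝ)) := by
        rw [h4, ENNReal.ofReal_tsum_of_nonneg (fun _ => by positivity) h3]
    _ ≤ _ := by
        rw [ENNReal.ofReal_rpow_of_nonneg (norm_nonneg _) zero_le_two]
        gcongr

/-- The equivalence `(x, y) ↦ (y, y⁻¹ x)` of `G × G`. -/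
def convEquiv (G : Type u) [Group G] : G × G ≃ G × G where
  toFun z := (z.2, z.2⁻¹ * z.1)
  invFun z := (z.1 * z.2, z.1)
  left_inv z := by simp
  right_inv z := by simp

theorem summable_conv_prod (hf : Summable fun g => ‖f g‖) (hh : Summable fun g => ‖h g‖) :
    Summable fun z : G × G => f z.2 * h (z.2⁻¹ * z.1) :=
  (convEquiv G).summable_iff.2 (summable_mul_of_summable_norm hf hh)

/-- The product of two absolutely convergent series is a sum over pairs; it is regrouped along the
pairs with a given product `x`. -/
theorem regRep_mul (hf : Summable fun g => ‖f g‖) (hh : Summable fun g => ‖h g‖) :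
    regRep f * regRep h = regRep fun x => ∑' y, f y * h (y⁻¹ * x) := by
  have hsum := summable_mul_of_summable_norm (summable_norm_smul_leftRegular hf)
    (summable_norm_smul_leftRegular hh)
  have hterm : ∀ z : G × G, (f (convEquiv G z).1 • leftRegular (convEquiv G z).1) *
      (h (convEquiv G z).2 • leftRegular (convEquiv G z).2) =
      (f z.2 * h (z.2⁻¹ * z.1)) • leftRegular z.1 := fun z => by
    change (f z.2 • leftRegular z.2) * (h (z.2⁻¹ * z.1) • leftRegular (z.2⁻¹ * z.1)) = _
    rw [smul_mul_smul_comm, ← leftRegular_mul, mul_inv_cancel_left]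
  have hs1 : Summable fun z : G × G => (f z.2 * h (z.2⁻¹ * z.1)) • leftRegular z.1 := by
    have := (convEquiv G).summable_iff.2 hsum
    refine this.congr fun z => ?_
    exact hterm z
  rw [regRep, regRep, tsum_mul_tsum_of_summable_norm (summable_norm_smul_leftRegular hf)
    (summable_norm_smul_leftRegular hh), ← (convEquiv G).tsum_eq]
  simp only [hterm]
  rw [hs1.tsum_prod, regRep]
  refine tsum_congr fun x => ?_
  have hx : Summable fun y => f y * h (y⁻¹ * x) := (summable_conv_prod hf hh).prod_factor x
  exact hx.tsum_smul_const (leftRegular x)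

theorem star_regRep (f : G → ℂ) : star (regRep f) = regRep fun x => star (f x⁻¹) := by
  have h : star (∑' g, f g • leftRegular g) = ∑' g, star (f g • leftRegular g) := tsum_star
  rw [regRep, h, regRep, ← (Equiv.inv G).tsum_eq]
  simp [star_smul, star_leftRegular]

end RegularRepresentation

/-! ### The weighted algebra and a general criterion on the weight -/

section WeightedAlgebra

theorem le_toReal_mul_of_ofReal_le {x y : ℝ} {Z : ℝ≥0∞} (hZ : Z ≠ ⊤) (hy : 0 ≤ y)
    (h : ENNReal.ofReal x ≤ Z * ENNReal.ofReal y) : x ≤ Z.toReal * y := by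
  rw [← ENNReal.ofReal_toReal hZ, ← ENNReal.ofReal_mul ENNReal.toReal_nonneg] at h
  exact (ENNReal.ofReal_le_ofReal_iff (by positivity)).1 h

/-- For `s (1 - 1/P) < 1 - γ` the interpolation inequality is available for some `θ < 1`. -/
theorem exists_interpolation_exponent {γ s P : ℝ} (hP : 1 ≤ P) (hγ0 : 0 ≤ γ) (hs : 0 < s)
    (h : s * (1 - 1 / P) < 1 - γ) :
    ∃ θ : ℝ, 0 < θ ∧ θ < 1 ∧ s * ((1 + θ) / 2 - θ / P) ≤ θ - γ := by
  set v := 1 / P with hv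
  have hv0 : 0 < v := by positivity
  have hv1 : v ≤ 1 := by rw [hv, div_le_one (by linarith)]; exact hP
  -- `δ` is the slack in the required inequality at `θ = 1`. Lowering `θ` by `ε` costs at most `ε (1
  -- + s)`, so this `ε` spends only half of it.
  set δ := 1 - γ - s * (1 - v) with hδ
  have hδ0 : 0 < δ := by linarith
  have hδ1 : δ ≤ 1 := by nlinarith
  set ε := δ / (2 * (1 + s)) with hε
  have hε0 : 0 < ε := by positivity
  have hεs : ε * (1 + s) = δ / 2 := by rw [hε]; field_simp
  have hε1 : ε ≤ 1 / 2 := by nlinarith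
  refine ⟨1 - ε, by linarith, by linarith, ?_⟩
  have e : (1 - ε) / P = (1 - ε) * v := by rw [hv]; ring
  rw [e]
  nlinarith [mul_pos hε0 hs, mul_nonneg (mul_pos hε0 hs).le hv0.le]

variable {G : Type u} [Group G] {p : ℝ≥0∞} {ω : Weight G}

/-- The weight `ω` with values in `ℝ≥0∞`. -/
noncomputable def Weight.ennreal (ω : Weight G) (x : G) : ℝ≥0∞ := ENNReal.ofReal (ω x)

theorem Weight.one_le_ennreal (ω : Weight G) (x : G) : 1 ≤ ω.ennreal x :=
  ENNReal.one_le_ofReal.2 (ω.one_le x)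

theorem Weight.one_le_ennreal_rpow (ω : Weight G) (x : G) {γ : ℝ} (hγ : 0 ≤ γ) :
    1 ≤ ω.ennreal x ^ γ := by
  simpa using ENNReal.rpow_le_rpow (ω.one_le_ennreal x) hγ

theorem Weight.ennreal_ne_top (ω : Weight G) (x : G) : ω.ennreal x ≠ ⊤ := ENNReal.ofReal_ne_top

theorem enorm_mul_weight (ω : Weight G) (f : G → ℂ) (x : G) :
    ‖f x * (ω x : ℂ)‖ₑ = ‖f x‖ₑ * ω.ennreal x := by
  rw [enorm_mul, Weight.ennreal, ← ofReal_norm (ω x : ℂ), Complex.norm_real, Real.norm_eq_abs,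
    abs_of_nonneg (ω.nonneg x)]

theorem ofReal_norm_mul_weight_rpow (ω : Weight G) (f : G → ℂ) (x : G) {P : ℝ} (hP : 0 ≤ P) :
    ENNReal.ofReal (‖f x * (ω x : ℂ)‖ ^ P) = (‖f x‖ₑ * ω.ennreal x) ^ P := by
  rw [← ENNReal.ofReal_rpow_of_nonneg (norm_nonneg _) hP, ofReal_norm, enorm_mul_weight]

theorem mem_weightedLpSubmodule_of_tsum_ne_top (hp : 0 < p.toReal) {f : G → ℂ}
    (hf : ∑' x, (‖f x‖ₑ * ω.ennreal x) ^ p.toReal ≠ ⊤) : f ∈ weightedLpSubmodule p ω := by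
  change Memℓp (fun x => f x * (ω x : ℂ)) p
  rw [memℓp_gen_iff hp]
  have := ENNReal.summable_toReal hf
  refine this.congr fun x => ?_
  rw [← ofReal_norm_mul_weight_rpow ω f x hp.le, ENNReal.toReal_ofReal (by positivity)]

/-- A function with finite weighted norm, as an element of `ℓ^p(G, ω)`. -/
def WeightedLp.ofTsumNeTop (hp : 0 < p.toReal) (f : G → ℂ)
    (hf : ∑' x, (‖f x‖ₑ * ω.ennreal x) ^ p.toReal ≠ ⊤) : WeightedLp p ω :=
  ⟨f, mem_weightedLpSubmodule_of_tsum_ne_top hp hf⟩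

theorem ofReal_norm_rpow_eq_tsum [Fact (1 ≤ p)] (hp : 0 < p.toReal) (f : WeightedLp p ω) :
    ENNReal.ofReal ‖f‖ ^ p.toReal = ∑' x, (‖f x‖ₑ * ω.ennreal x) ^ p.toReal := by
  have h1 := lp.norm_rpow_eq_tsum hp (WeightedLp.mulWeight p ω f)
  have h2 : Summable fun x => ‖f x * (ω x : ℂ)‖ ^ p.toReal := (memℓp_gen_iff hp).1 f.2
  change ‖f‖ ^ p.toReal = ∑' x, ‖f x * (ω x : ℂ)‖ ^ p.toReal at h1
  rw [ENNReal.ofReal_rpow_of_nonneg (norm_nonneg _) hp.le, h1,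
    ENNReal.ofReal_tsum_of_nonneg (fun _ => by positivity) h2]
  exact tsum_congr fun x => ofReal_norm_mul_weight_rpow ω f x hp.le

theorem ofReal_norm_eq_tsum_rpow [Fact (1 ≤ p)] (hp : 0 < p.toReal) (f : WeightedLp p ω) :
    ENNReal.ofReal ‖f‖ = (∑' x, (‖f x‖ₑ * ω.ennreal x) ^ p.toReal) ^ (1 / p.toReal) := by
  rw [← ofReal_norm_rpow_eq_tsum hp, ← ENNReal.rpow_mul, mul_one_div_cancel hp.ne',
    ENNReal.rpow_one]

/-- The involution `f*(x) = conj (f(x⁻¹))` preserves the weighted norm. -/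
theorem exists_involution [Fact (1 ≤ p)] (hp : 0 < p.toReal) (f : WeightedLp p ω) :
    ∃ k : WeightedLp p ω, (∀ x, k x = star (f x⁻¹)) ∧ ‖k‖ = ‖f‖ := by
  have e : ∑' x, (‖star (f x⁻¹)‖ₑ * ω.ennreal x) ^ p.toReal =
      ∑' x, (‖f x‖ₑ * ω.ennreal x) ^ p.toReal := by
    rw [← (Equiv.inv G).tsum_eq]
    refine tsum_congr fun x => ?_
    have h1 : ‖star (f x)‖ₑ = ‖f x‖ₑ := by rw [← ofReal_norm, norm_star, ofReal_norm]
    simp only [Equiv.inv_apply, inv_inv, h1, Weight.ennreal, ω.map_inv]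
  have hfin : ∑' x, (‖star (f x⁻¹)‖ₑ * ω.ennreal x) ^ p.toReal ≠ ⊤ := by
    rw [e, ← ofReal_norm_rpow_eq_tsum hp]
    exact ENNReal.rpow_ne_top_of_nonneg hp.le ENNReal.ofReal_ne_top
  refine ⟨.ofTsumNeTop hp _ hfin, fun _ => rfl, ?_⟩
  rw [← ENNReal.toReal_ofReal (norm_nonneg f), ofReal_norm_eq_tsum_rpow hp f, ← e,
    ← ENNReal.toReal_ofReal (norm_nonneg (WeightedLp.ofTsumNeTop hp _ hfin)),
    ofReal_norm_eq_tsum_rpow hp]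
  rfl

theorem exists_unit (hp : 0 < p.toReal) [DecidableEq G] :
    ∃ k : WeightedLp p ω, ∀ x, k x = Pi.single (M := fun _ : G => ℂ) 1 1 x := by
  refine ⟨.ofTsumNeTop hp (Pi.single 1 1) ?_, fun _ => rfl⟩
  rw [tsum_eq_single 1 (fun x hx => by simp [Pi.single_eq_of_ne hx, hp])]
  exact ENNReal.rpow_ne_top_of_nonneg hp.le
    (ENNReal.mul_ne_top enorm_ne_top (ω.ennreal_ne_top 1))

theorem regRep_single [DecidableEq G] : regRep (Pi.single (M := fun _ : G => ℂ) 1 1) = 1 := by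
  rw [regRep, tsum_eq_single 1 (fun x hx => by simp [Pi.single_eq_of_ne hx])]
  simp [leftRegular_one]

theorem summable_norm_of_tsum_mul_ne_top {γ : ℝ} (hγ : 0 ≤ γ) {f : G → ℂ}
    (hf : ∑' x, ‖f x‖ₑ * ω.ennreal x ^ γ ≠ ⊤) : Summable fun x => ‖f x‖ := by
  have h : ∑' x, ‖f x‖ₑ ≠ ⊤ := by
    refine ne_top_of_le_ne_top hf (ENNReal.tsum_le_tsum fun x => ?_)
    exact le_mul_of_one_le_right' (ω.one_le_ennreal_rpow x hγ)
  simpa using ENNReal.summable_toReal h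

theorem tsum_norm_le_toReal {γ : ℝ} (hγ : 0 ≤ γ) {f : G → ℂ}
    (hf : ∑' x, ‖f x‖ₑ * ω.ennreal x ^ γ ≠ ⊤) :
    ∑' x, ‖f x‖ ≤ (∑' x, ‖f x‖ₑ * ω.ennreal x ^ γ).toReal := by
  have h : ∑' x, ‖f x‖ₑ ≤ ∑' x, ‖f x‖ₑ * ω.ennreal x ^ γ := ENNReal.tsum_le_tsum fun x =>
    le_mul_of_one_le_right' (ω.one_le_ennreal_rpow x hγ)
  calc ∑' x, ‖f x‖ = (∑' x, ‖f x‖ₑ).toReal := by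
        rw [ENNReal.tsum_toReal_eq fun _ => enorm_ne_top]
        simp
    _ ≤ _ := ENNReal.toReal_mono hf h

/-- Convolution on `ℓ^p(G, ω)`. -/
theorem exists_conv [Fact (1 ≤ p)] (hp : 1 ≤ p.toReal) {C : ℝ≥0∞} (hC : C ≠ ⊤) {γ : ℝ}
    (hγ : 0 ≤ γ)
    (hω : ∀ x y, ω.ennreal (x * y) ≤
      C * (ω.ennreal x * ω.ennreal y ^ γ + ω.ennreal x ^ γ * ω.ennreal y))
    (f g : WeightedLp p ω) (hf : ∑' x, ‖f x‖ₑ * ω.ennreal x ^ γ ≠ ⊤)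
    (hg : ∑' x, ‖g x‖ₑ * ω.ennreal x ^ γ ≠ ⊤) :
    ∃ k : WeightedLp p ω, (∀ x : G, HasSum (fun y => f y * g (y⁻¹ * x)) (k x)) ∧
      regRep k = regRep f * regRep g ∧
      ENNReal.ofReal ‖k‖ ≤ 2 * C * (ENNReal.ofReal ‖f‖ * (∑' x, ‖g x‖ₑ * ω.ennreal x ^ γ) +
        (∑' x, ‖f x‖ₑ * ω.ennreal x ^ γ) * ENNReal.ofReal ‖g‖) := by
  have hp0 : 0 < p.toReal := by linarith
  set N : ℝ≥0∞ := 2 * C * (ENNReal.ofReal ‖f‖ * (∑' x, ‖g x‖ₑ * ω.ennreal x ^ γ) +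
        (∑' x, ‖f x‖ₑ * ω.ennreal x ^ γ) * ENNReal.ofReal ‖g‖) with hN
  have hNt : N ≠ ⊤ := ENNReal.mul_ne_top (ENNReal.mul_ne_top (by norm_num) hC)
    (ENNReal.add_ne_top.2 ⟨ENNReal.mul_ne_top ENNReal.ofReal_ne_top hg,
      ENNReal.mul_ne_top hf ENNReal.ofReal_ne_top⟩)
  have hbound : ∑' x, (‖∑' y, f y * g (y⁻¹ * x)‖ₑ * ω.ennreal x) ^ p.toReal ≤ N ^ p.toReal := by
    have h := tsum_conv_mul_weight_rpow_le (fun x => ‖f x‖ₑ) (fun x => ‖g x‖ₑ)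
      (fun x => ‖∑' y, f y * g (y⁻¹ * x)‖ₑ) ω.ennreal hp hω (fun x => by
        refine (enorm_tsum_le_tsum_enorm).trans (le_of_eq (tsum_congr fun y => enorm_mul _ _)))
    rw [← ofReal_norm_rpow_eq_tsum hp0, ← ofReal_norm_rpow_eq_tsum hp0,
      ← ENNReal.mul_rpow_of_nonneg _ _ hp0.le, ← ENNReal.mul_rpow_of_nonneg _ _ hp0.le] at h
    refine h.trans ?_
    -- To reach the single power `N^p`, `2^(p-1)` is enlarged to `2^p` and `A^p + B^p` to `(A +
    -- B)^p`.
    rw [hN, mul_comm 2 C, ENNReal.mul_rpow_of_nonneg (C * 2) _ hp0.le,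
      ENNReal.mul_rpow_of_nonneg C 2 hp0.le]
    gcongr
    · norm_num
    · linarith
    · exact ENNReal.add_rpow_le_rpow_add _ _ hp
  have hsf := summable_norm_of_tsum_mul_ne_top hγ hf
  have hsg := summable_norm_of_tsum_mul_ne_top hγ hg
  refine ⟨.ofTsumNeTop hp0 (fun x => ∑' y, f y * g (y⁻¹ * x))
    (ne_top_of_le_ne_top (ENNReal.rpow_ne_top_of_nonneg hp0.le hNt) hbound), fun x => ?_,
    (regRep_mul hsf hsg).symm, ?_⟩
  · exact ((summable_conv_prod hsf hsg).prod_factor x).hasSum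
  · rw [ofReal_norm_eq_tsum_rpow hp0]
    calc _ ≤ (N ^ p.toReal) ^ (1 / p.toReal) := ENNReal.rpow_le_rpow hbound (by positivity)
      _ = N := by rw [← ENNReal.rpow_mul, mul_one_div_cancel hp0.ne', ENNReal.rpow_one]

/-- The embedding of `ℓ^p(G, ω)` in `C*_r(G)`, given a bound of a weighted `ℓ¹`-norm. -/
noncomputable def regRepCLM [Fact (1 ≤ p)] {γ : ℝ} (hγ : 0 ≤ γ) {Z : ℝ≥0∞} (hZ : Z ≠ ⊤)
    (h1 : ∀ f : WeightedLp p ω, ∑' x, ‖f x‖ₑ * ω.ennreal x ^ γ ≤ Z * ENNReal.ofReal ‖f‖) :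
    WeightedLp p ω →L[ℂ] reducedCStar G :=
  have ht (f : WeightedLp p ω) : ∑' x, ‖f x‖ₑ * ω.ennreal x ^ γ ≠ ⊤ :=
    ne_top_of_le_ne_top (ENNReal.mul_ne_top hZ ENNReal.ofReal_ne_top) (h1 f)
  have hs (f : WeightedLp p ω) : Summable fun x => ‖f x‖ := summable_norm_of_tsum_mul_ne_top hγ (ht f)
  LinearMap.mkContinuous
    { toFun := fun f => ⟨regRep f, regRep_mem (hs f)⟩
      map_add' := fun f g => by
        apply Subtype.ext
        refine (hasSum_regRep (hs (f + g))).unique ?_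
        refine ((hasSum_regRep (hs f)).add (hasSum_regRep (hs g))).congr_fun fun x => ?_
        exact add_smul _ _ _
      map_smul' := fun c f => by
        apply Subtype.ext
        refine (hasSum_regRep (hs (c • f))).unique ?_
        refine ((hasSum_regRep (hs f)).const_smul c).congr_fun fun x => ?_
        exact mul_smul _ _ _ }
    Z.toReal fun f => by
      refine (norm_regRep_le (hs f)).trans ((tsum_norm_le_toReal hγ (ht f)).trans ?_)
      refine (ENNReal.toReal_mono (ENNReal.mul_ne_top hZ ENNReal.ofReal_ne_top) (h1 f)).trans ?_
      rw [ENNReal.toReal_mul, ENNReal.toReal_ofReal (norm_nonneg f)]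

/-- The weighted `ℓ¹`-norm with weight `ω^γ` is interpolated twice: at `θ = 1` it is bounded by
`‖f‖_{p,ω}`, giving the embedding and the Banach algebra structure; at some `θ < 1` it gives the
differential norm inequality. The condition `hs` is strict precisely to leave room for the second.
-/
theorem admitsNormControlledInversion_of_weight [Fact (1 ≤ p)] (hpt : p ≠ ⊤) {C : ℝ≥0∞}
    (hC : C ≠ ⊤) {γ s : ℝ} (hγ : 0 ≤ γ) (hs0 : 0 < s)
    (hs : s * (1 - 1 / p.toReal) < 1 - γ)
    (hω : ∀ x y, ω.ennreal (x * y) ≤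
      C * (ω.ennreal x * ω.ennreal y ^ γ + ω.ennreal x ^ γ * ω.ennreal y))
    (hsum : ∑' x, ω.ennreal x ^ (-s) ≠ ⊤) : AdmitsNormControlledInversion p ω := by
  classical
  have hp : 1 ≤ p.toReal := by
    have := ENNReal.toReal_mono hpt (Fact.out : 1 ≤ p)
    simpa using this
  have hp0 : 0 < p.toReal := by linarith
  set Z₁ : ℝ≥0∞ := (∑' x, ω.ennreal x ^ (-s)) ^ (1 - 1 / p.toReal) with hZ₁
  have hZ₁t : Z₁ ≠ ⊤ := ENNReal.rpow_ne_top_of_nonneg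
    (by rw [sub_nonneg, div_le_one hp0]; exact hp) hsum
  have h1 : ∀ f : WeightedLp p ω,
      ∑' x, ‖f x‖ₑ * ω.ennreal x ^ γ ≤ Z₁ * ENNReal.ofReal ‖f‖ := fun f => by
    -- At `θ = 1` the `ℓ²` factor disappears and this is Hölder's inequality between `ω f` and a
    -- power of `ω`.
    have := tsum_mul_rpow_le_interpolate (fun x => ‖f x‖ₑ) ω.ennreal (θ := 1) (γ := γ) hp
      zero_le_one le_rfl ω.one_le_ennreal ω.ennreal_ne_top (s := s) (by linarith)
    rw [show ((1 : ℝ) - 1) / 2 = 0 by norm_num, show ((1 : ℝ) + 1) / 2 = 1 by norm_num,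
      ENNReal.rpow_zero, one_mul, ← ofReal_norm_eq_tsum_rpow hp0, mul_comm] at this
    exact this
  have ht (f : WeightedLp p ω) : ∑' x, ‖f x‖ₑ * ω.ennreal x ^ γ ≠ ⊤ :=
    ne_top_of_le_ne_top (ENNReal.mul_ne_top hZ₁t ENNReal.ofReal_ne_top) (h1 f)
  have hsf (f : WeightedLp p ω) : Summable fun x => ‖f x‖ :=
    summable_norm_of_tsum_mul_ne_top hγ (ht f)
  set ι := regRepCLM hγ hZ₁t h1 with hι
  have hιf (f : WeightedLp p ω) : (ι f : L2 G →L[ℂ] L2 G) = regRep f := rfl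
  have hinj : Function.Injective ι := fun f g hfg => by
    apply Subtype.ext
    funext x
    have h2 : regRep f = regRep g := congrArg Subtype.val hfg
    rw [← regRep_apply_single (hsf f) x, ← regRep_apply_single (hsf g) x, h2]
  have hconv : ∀ f g : WeightedLp p ω, ∃ k : WeightedLp p ω,
      (∀ x : G, HasSum (fun y => f y * g (y⁻¹ * x)) (k x)) ∧ ι k = ι f * ι g ∧
      ENNReal.ofReal ‖k‖ ≤ 2 * C * (ENNReal.ofReal ‖f‖ * (∑' x, ‖g x‖ₑ * ω.ennreal x ^ γ) +
        (∑' x, ‖f x‖ₑ * ω.ennreal x ^ γ) * ENNReal.ofReal ‖g‖) := fun f g => by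
    obtain ⟨k, hk1, hk2, hk3⟩ := exists_conv hp hC hγ hω f g (ht f) (ht g)
    exact ⟨k, hk1, Subtype.ext hk2, hk3⟩
  obtain ⟨θ, hθ0, hθ1, hθ⟩ := exists_interpolation_exponent hp hγ hs0 hs
  set Z : ℝ≥0∞ := (∑' x, ω.ennreal x ^ (-s)) ^ ((1 + θ) / 2 - θ / p.toReal) with hZ
  have hZt : Z ≠ ⊤ := by
    refine ENNReal.rpow_ne_top_of_nonneg ?_ hsum
    have : θ / p.toReal ≤ θ := div_le_self hθ0.le hp
    linarith
  have hinter : ∀ f : WeightedLp p ω, ∑' x, ‖f x‖ₑ * ω.ennreal x ^ γ ≤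
      ENNReal.ofReal ‖ι f‖ ^ (1 - θ) * ENNReal.ofReal ‖f‖ ^ θ * Z := fun f => by
    refine (tsum_mul_rpow_le_interpolate (fun x => ‖f x‖ₑ) ω.ennreal hp hθ0.le hθ1.le
      ω.one_le_ennreal ω.ennreal_ne_top hθ).trans ?_
    rw [← ofReal_norm_rpow_eq_tsum hp0, ← ENNReal.rpow_mul, mul_div_cancel₀ _ hp0.ne']
    gcongr
    calc _ ≤ (ENNReal.ofReal ‖regRep f‖ ^ (2 : ℝ)) ^ ((1 - θ) / 2) :=
          ENNReal.rpow_le_rpow (tsum_norm_sq_le_norm_regRep (hsf f)) (by linarith)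
      _ = ENNReal.ofReal ‖ι f‖ ^ (1 - θ) := by
          rw [← ENNReal.rpow_mul]
          congr 1
          ring
  have hBanach : IsBanachSubalgebra ι :=
    { injective := hinj
      one_mem := by
        obtain ⟨k, hk⟩ := exists_unit (p := p) (ω := ω) hp0
        refine ⟨k, Subtype.ext ?_⟩
        rw [hιf, show (k : G → ℂ) = Pi.single 1 1 from funext hk, regRep_single]
        rfl
      mul_mem := fun a b => by
        obtain ⟨k, -, hk, -⟩ := hconv a b
        exact ⟨k, hk⟩
      norm_mul_le := by
        refine ⟨(4 * C * Z₁).toReal, fun a b c hc => ?_⟩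
        obtain ⟨k, -, hk, hkn⟩ := hconv a b
        obtain rfl : c = k := hinj (hc.trans hk.symm)
        rw [mul_assoc]
        refine le_toReal_mul_of_ofReal_le
          (ENNReal.mul_ne_top (ENNReal.mul_ne_top (by norm_num) hC) hZ₁t) (by positivity)
          (hkn.trans ?_)
        rw [ENNReal.ofReal_mul (norm_nonneg _)]
        calc _ ≤ 2 * C * (ENNReal.ofReal ‖a‖ * (Z₁ * ENNReal.ofReal ‖b‖) +
              (Z₁ * ENNReal.ofReal ‖a‖) * ENNReal.ofReal ‖b‖) := by gcongr <;> exact h1 _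
          _ = _ := by ring }
  refine ⟨ι, fun f ξ x => hasSum_regRep_apply (hsf f) ξ x, fun f g => ?_,
    normControlledInversion_of_differential hBanach (fun a => ?_)
      -- The `1` only ensures a strictly positive constant.
      (C := (4 * C * Z).toReal + 1) (θ := θ) (by positivity) hθ0 hθ1 fun a c hc => ?_⟩
  · obtain ⟨k, hk1, hk2, -⟩ := hconv f g
    exact ⟨k, hk1, hk2⟩
  · obtain ⟨k, hk, hkn⟩ := exists_involution hp0 a
    refine ⟨k, Subtype.ext ?_, hkn.le⟩
    change regRep k = star (regRep a)
    rw [star_regRep]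
    congr 1
    exact funext hk
  · obtain ⟨k, -, hk, hkn⟩ := hconv a a
    obtain rfl : c = k := hinj (hc.trans hk.symm)
    have : ‖c‖ ≤ (4 * C * Z).toReal * (‖a‖ ^ (1 + θ) * ‖ι a‖ ^ (1 - θ)) := by
      refine le_toReal_mul_of_ofReal_le
        (ENNReal.mul_ne_top (ENNReal.mul_ne_top (by norm_num) hC) hZt) (by positivity)
        (hkn.trans ?_)
      rw [ENNReal.ofReal_mul (by positivity),
        ← ENNReal.ofReal_rpow_of_nonneg (norm_nonneg _) (by linarith),
        ← ENNReal.ofReal_rpow_of_nonneg (norm_nonneg _) (by linarith),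
        ENNReal.rpow_add_of_nonneg _ _ zero_le_one hθ0.le, ENNReal.rpow_one]
      set X := ∑' x, ‖a x‖ₑ * ω.ennreal x ^ γ
      calc _ = 4 * C * (ENNReal.ofReal ‖a‖ * X) := by ring
        _ ≤ 4 * C * (ENNReal.ofReal ‖a‖ *
            (ENNReal.ofReal ‖ι a‖ ^ (1 - θ) * ENNReal.ofReal ‖a‖ ^ θ * Z)) := by
            gcongr
            exact hinter a
        _ = _ := by ring
    rw [mul_assoc]
    refine this.trans ?_
    gcongr
    linarith

end WeightedAlgebra

/-! ### Step, polynomial and subexponential weights -/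

section ConcreteWeights

variable {G : Type u} [Group G]

theorem Weight.ennreal_mul_le {ω : Weight G} {C γ : ℝ} (hC : 0 ≤ C) (hγ : 0 ≤ γ)
    (h : ∀ x y, ω (x * y) ≤ C * (ω x * ω y ^ γ + ω x ^ γ * ω y)) (x y : G) :
    ω.ennreal (x * y) ≤ ENNReal.ofReal C *
      (ω.ennreal x * ω.ennreal y ^ γ + ω.ennreal x ^ γ * ω.ennreal y) := by
  have hx := ω.nonneg x
  have hy := ω.nonneg y
  simp only [Weight.ennreal]
  rw [ENNReal.ofReal_rpow_of_nonneg hx hγ, ENNReal.ofReal_rpow_of_nonneg hy hγ,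
    ← ENNReal.ofReal_mul hx, ← ENNReal.ofReal_mul (by positivity),
    ← ENNReal.ofReal_add (by positivity) (by positivity), ← ENNReal.ofReal_mul hC]
  exact ENNReal.ofReal_le_ofReal (h x y)

theorem Weight.ennreal_rpow_neg (ω : Weight G) (s : ℝ) (x : G) :
    ω.ennreal x ^ (-s) = ENNReal.ofReal (ω x ^ (-s)) :=
  ENNReal.ofReal_rpow_of_pos (zero_lt_one.trans_le (ω.one_le x))

/-- Each point is charged to one set of the cover on which `g` is controlled. The sets may overlap,
so balls can be used instead of spheres. -/
theorem tsum_le_tsum_mul_encard {α : Type*} {g : α → ℝ≥0∞} {F : ℕ → Set α} {c : ℕ → ℝ≥0∞}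
    (h : ∀ x, ∃ j, x ∈ F j ∧ g x ≤ c j) : ∑' x, g x ≤ ∑' j, c j * ((F j).encard : ℝ≥0∞) := by
  calc ∑' x, g x ≤ ∑' x, ∑' j, (F j).indicator (fun _ => c j) x := by
        refine ENNReal.tsum_le_tsum fun x => ?_
        obtain ⟨j, hj, hg⟩ := h x
        refine le_trans ?_ (ENNReal.le_tsum j)
        rwa [Set.indicator_of_mem hj]
    _ = _ := by
        rw [ENNReal.tsum_comm]
        refine tsum_congr fun j => ?_
        rw [← tsum_subtype, ← ENNReal.tsum_set_one, ← ENNReal.tsum_mul_left]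
        simp

theorem tsum_ennreal_rpow_neg_ne_top {ω : Weight G} {s : ℝ} {F : ℕ → Set G} {c : ℕ → ℝ}
    (hF : ∀ j, (F j).Finite) (hc : ∀ j, 0 ≤ c j)
    (h : ∀ x, ∃ j, x ∈ F j ∧ ω x ^ (-s) ≤ c j)
    (hs : Summable fun j => c j * ((F j).ncard : ℝ)) : ∑' x, ω.ennreal x ^ (-s) ≠ ⊤ := by
  refine ne_top_of_le_ne_top hs.tsum_ofReal_ne_top
    ((tsum_le_tsum_mul_encard (c := fun j => ENNReal.ofReal (c j)) (F := F) fun x => ?_).trans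
      (le_of_eq (tsum_congr fun j => ?_)))
  · obtain ⟨j, hj, hx⟩ := h x
    exact ⟨j, hj, by rw [ω.ennreal_rpow_neg]; exact ENNReal.ofReal_le_ofReal hx⟩
  · rw [ENNReal.ofReal_mul (hc j), ← (hF j).cast_ncard_eq, ENNReal.ofReal_natCast]
    rfl

theorem one_sub_one_div_toReal_eq {p q : ℝ≥0∞} (hpq : p⁻¹ + q⁻¹ = 1) :
    1 - 1 / p.toReal = q⁻¹.toReal := by
  have h1 : p⁻¹ ≠ ⊤ := ne_top_of_le_ne_top ENNReal.one_ne_top (hpq ▸ le_self_add)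
  have h2 : q⁻¹ ≠ ⊤ := ne_top_of_le_ne_top ENNReal.one_ne_top (hpq ▸ le_add_self)
  have := congrArg ENNReal.toReal hpq
  rw [ENNReal.toReal_add h1 h2, ENNReal.toReal_inv, ENNReal.toReal_one] at this
  rw [one_div]
  linarith

theorem toReal_mul_inv_toReal_lt_one {s q : ℝ≥0∞} (hsq : s < q) :
    s.toReal * q⁻¹.toReal < 1 := by
  have h : s * q⁻¹ < 1 := by
    rw [← div_eq_mul_inv, ENNReal.div_lt_iff (Or.inl (ne_zero_of_lt hsq)) (Or.inr hsq.ne_top),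
      one_mul]
    exact hsq
  rw [← ENNReal.toReal_mul]
  simpa using (ENNReal.toReal_lt_toReal h.ne_top ENNReal.one_ne_top).2 h

/-- The step weight satisfies `ω(xy) ≤ max (ω x) (ω y) ≤ ω x + ω y`, so the criterion applies with
`γ = 0`; its exponent condition becomes `s / q < 1`. -/
theorem stepWeight_admits {p q : ℝ≥0∞} [Fact (1 ≤ p)] (hp : p ≠ ⊤) (hpq : p⁻¹ + q⁻¹ = 1)
    {H : ℕ → Subgroup G} (hH : Monotone H) (hcov : ∀ x, ∃ i, x ∈ H i) {n : ℕ → ℝ}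
    (hn : Monotone n) (hn1 : ∀ i, 1 ≤ n i) {s : ℝ≥0∞} (hs0 : 0 < s) (hsq : s < q)
    (hs : Memℓp (fun x => (stepWeight hH hcov hn hn1 x)⁻¹) s) :
    AdmitsNormControlledInversion p (stepWeight hH hcov hn hn1) := by
  set ω := stepWeight hH hcov hn hn1 with hω
  have hs0' : 0 < s.toReal := ENNReal.toReal_pos hs0.ne' hsq.ne_top
  refine admitsNormControlledInversion_of_weight hp (ENNReal.ofReal_ne_top (r := 1)) le_rfl hs0'
    ?_ (Weight.ennreal_mul_le zero_le_one le_rfl fun x y => ?_) ?_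
  · rw [one_sub_one_div_toReal_eq hpq, sub_zero]
    exact toReal_mul_inv_toReal_lt_one hsq
  · have h1 : ω (x * y) ≤ max (ω x) (ω y) := stepFun_mul_le hH hcov hn hn1 x y
    have hx := ω.nonneg x
    have hy := ω.nonneg y
    simp only [Real.rpow_zero, one_mul, mul_one]
    exact h1.trans (max_le (by linarith) (by linarith))
  · rw [memℓp_gen_iff hs0'] at hs
    simp only [Weight.ennreal_rpow_neg]
    refine Summable.tsum_ofReal_ne_top (hs.congr fun x => ?_)
    rw [Real.rpow_neg (ω.nonneg x), Real.norm_of_nonneg (inv_nonneg.2 (ω.nonneg x)),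
      Real.inv_rpow (ω.nonneg x)]

theorem IsSymmGenSet.mem_pow_of_len_le {U : Set G} (hU : IsSymmGenSet U) {x : G} {n : ℕ}
    (h : len U x ≤ n) : x ∈ U ^ n :=
  Set.pow_subset_pow_right hU.one_mem h (hU.mem_pow_len x)

theorem IsSymmGenSet.finite_pow {U : Set G} (hU : IsSymmGenSet U) (n : ℕ) : (U ^ n).Finite := by
  induction n with
  | zero => simp
  | succ n ih => rw [pow_succ]; exact ih.mul hU.finite

/-- The argument `1 + τ(xy)` is at most twice the larger of `1 + τ(x)` and `1 + τ(y)`. This is the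
criterion's condition with `γ = 0`. -/
theorem polyWeight_mul_le {U : Set G} (hU : IsSymmGenSet U) {β : ℝ} (hβ : 0 < β) (x y : G) :
    polyWeight hU hβ (x * y) ≤ 2 ^ β * (polyWeight hU hβ x + polyWeight hU hβ y) := by
  change (1 + (len U (x * y) : ℝ)) ^ β ≤
    2 ^ β * ((1 + (len U x : ℝ)) ^ β + (1 + (len U y : ℝ)) ^ β)
  have h : (len U (x * y) : ℝ) ≤ len U x + len U y := by exact_mod_cast hU.len_mul_le x y
  wlog hxy : len U y ≤ len U x generalizing x y
  · have h' : (len U (x * y) : ℝ) ≤ len U y + len U x := by linarith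
    rw [add_comm ((1 + (len U x : ℝ)) ^ β)]
    have h2 := @Real.rpow_le_rpow (1 + (len U (x * y) : ℝ)) (2 * (1 + (len U y : ℝ))) β
      (by positivity) (by
        have : (len U x : ℝ) ≤ len U y := by exact_mod_cast (not_le.1 hxy).le
        linarith) hβ.le
    rw [Real.mul_rpow zero_le_two (by positivity)] at h2
    refine h2.trans ?_
    gcongr
    exact le_add_of_nonneg_right (by positivity)
  have h2 := @Real.rpow_le_rpow (1 + (len U (x * y) : ℝ)) (2 * (1 + (len U x : ℝ))) β
    (by positivity) (by
      have : (len U y : ℝ) ≤ len U x := by exact_mod_cast hxy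
      linarith) hβ.le
  rw [Real.mul_rpow zero_le_two (by positivity)] at h2
  refine h2.trans ?_
  gcongr
  exact le_add_of_nonneg_right (by positivity)

/-- Dyadic balls turn the sum into a geometric series of ratio `2^(d - βs)`. Summing over balls of
every radius would instead require the stronger condition `d + 1 < βs`. -/
theorem tsum_polyWeight_rpow_neg_ne_top {U : Set G} (hU : IsSymmGenSet U) {β : ℝ} (hβ : 0 < β)
    {d : ℕ} (hd : GrowthLE U d) {s : ℝ} (hs : d < β * s) :
    ∑' x, (polyWeight hU hβ).ennreal x ^ (-s) ≠ ⊤ := by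
  obtain ⟨K, hK0, hK⟩ := hd
  refine tsum_ennreal_rpow_neg_ne_top (F := fun j => U ^ 2 ^ (j + 1))
    (c := fun j => ((2 : ℝ) ^ (-(β * s))) ^ j) (fun j => hU.finite_pow _)
    (fun j => by positivity) (fun x => ?_) ?_
  · refine ⟨Nat.log 2 (1 + len U x), hU.mem_pow_of_len_le ?_, ?_⟩
    · have := Nat.lt_pow_succ_log_self (b := 2) one_lt_two (1 + len U x)
      simp only [Nat.succ_eq_add_one] at this
      omega
    · have h1 : ((2 ^ Nat.log 2 (1 + len U x) : ℕ) : ℝ) ≤ ((1 + len U x : ℕ) : ℝ) :=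
        Nat.cast_le.2 (Nat.pow_log_le_self 2 (by omega))
      push_cast at h1
      change ((1 + (len U x : ℝ)) ^ β) ^ (-s) ≤ _
      rw [← Real.rpow_mul (by positivity), mul_neg, ← Real.rpow_natCast,
        ← Real.rpow_mul zero_le_two, mul_comm (-(β * s)), Real.rpow_mul zero_le_two,
        Real.rpow_natCast]
      exact Real.rpow_le_rpow_of_nonpos (by positivity) h1
        (by linarith [(Nat.cast_nonneg d : (0 : ℝ) ≤ d)])
  · have hr : (2 : ℝ) ^ (-(β * s)) * 2 ^ d < 1 := by
      rw [← Real.rpow_natCast, ← Real.rpow_add two_pos]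
      exact Real.rpow_lt_one_of_one_lt_of_neg one_lt_two (by linarith)
    refine Summable.of_nonneg_of_le (fun j => by positivity) (fun j => ?_)
      ((summable_geometric_of_lt_one (by positivity) hr).mul_left (K * 2 ^ d))
    calc _ ≤ ((2 : ℝ) ^ (-(β * s))) ^ j * (K * ((2 ^ (j + 1) : ℕ) : ℝ) ^ d) := by
          gcongr
          exact hK _ Nat.one_le_two_pow
      _ = _ := by push_cast; ring

theorem polyWeight_admits {p q : ℝ≥0∞} [Fact (1 ≤ p)] (hp : p ≠ ⊤) (hpq : p⁻¹ + q⁻¹ = 1)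
    {U : Set G} (hU : IsSymmGenSet U) (hpoly : PolynomialGrowth U) {β : ℝ} (hβ : 0 < β)
    (hd : (growthOrder U : ℝ≥0∞) / q < ENNReal.ofReal β) :
    AdmitsNormControlledInversion p (polyWeight hU hβ) := by
  have hG : GrowthLE U (growthOrder U) := Nat.sInf_mem (s := {d : ℕ | GrowthLE U d}) hpoly
  set d := growthOrder U
  set v := q⁻¹.toReal with hv
  have hv0 : 0 ≤ v := ENNReal.toReal_nonneg
  have hv1 : v ≤ 1 := by
    have h2 : q⁻¹ ≤ 1 := hpq ▸ le_add_self
    rw [hv, ← ENNReal.toReal_one]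
    exact ENNReal.toReal_mono ENNReal.one_ne_top h2
  have hdv : d * v < β := by
    have := (ENNReal.toReal_lt_toReal hd.ne_top ENNReal.ofReal_ne_top).2 hd
    rwa [ENNReal.toReal_ofReal hβ.le, div_eq_mul_inv, ENNReal.toReal_mul,
      ENNReal.toReal_natCast] at this
  -- The exponent `s` must satisfy `s > d/β` and `s v < 1`. With `s = d/β + ε` one has `s v = 1 - 2ε
  -- + εv < 1`, since `v ≤ 1`.
  set ε := (1 - d * v / β) / 2 with hε
  have hε0 : 0 < ε := by
    have : d * v / β < 1 := (div_lt_one hβ).2 hdv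
    rw [hε]
    linarith
  have hs0 : 0 < d / β + ε := by positivity
  refine admitsNormControlledInversion_of_weight hp (ENNReal.ofReal_ne_top (r := 2 ^ β)) le_rfl hs0
    ?_ (Weight.ennreal_mul_le (by positivity) le_rfl fun x y => ?_)
    (tsum_polyWeight_rpow_neg_ne_top hU hβ hG ?_)
  · rw [one_sub_one_div_toReal_eq hpq, ← hv]
    have h1 : d / β * v = 1 - 2 * ε := by rw [hε]; ring
    nlinarith
  · simpa only [Real.rpow_zero, one_mul, mul_one] using polyWeight_mul_le hU hβ x y
  · rw [mul_add, mul_div_cancel₀ _ hβ.ne']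
    linarith [mul_pos hβ hε0]

/-- With `t = b/a ≤ 1`, Bernoulli gives `(1+t)^α ≤ 1 + αt ≤ 1 + α t^α`. The factor `α < 1` on the
smaller term is the gain over plain subadditivity. -/
theorem add_rpow_le_rpow_add_mul_rpow {a b α : ℝ} (hb : 0 ≤ b) (hba : b ≤ a) (hα0 : 0 ≤ α)
    (hα1 : α ≤ 1) : (a + b) ^ α ≤ a ^ α + α * b ^ α := by
  rcases (hb.trans hba).eq_or_lt with rfl | ha
  · obtain rfl : b = 0 := le_antisymm hba hb
    rw [add_zero]
    exact le_add_of_nonneg_right (by positivity)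
  have hba0 : 0 ≤ b / a := by positivity
  calc (a + b) ^ α = a ^ α * (1 + b / a) ^ α := by
        rw [← Real.mul_rpow ha.le (by positivity)]
        congr 1
        field_simp
    _ ≤ a ^ α * (1 + α * (b / a)) := by
        gcongr
        exact _root_.rpow_one_add_le_one_add_mul_self (by linarith) hα0 hα1
    _ ≤ a ^ α * (1 + α * (b / a) ^ α) := by
        gcongr
        exact Real.self_le_rpow_of_le_one hba0 ((div_le_one ha).2 hba) hα1
    _ = _ := by
        rw [Real.div_rpow hb ha.le]
        have := (Real.rpow_pos_of_pos ha α).ne'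
        field_simp

/-- The longer of `x` and `y` keeps its full weight, and by the previous inequality the shorter
contributes only its weight to the power `α`. Hence `γ = α`, one summand being enough in each case.
-/
theorem subexpWeight_mul_le {U : Set G} (hU : IsSymmGenSet U) {α C : ℝ} (hα0 : 0 < α)
    (hα1 : α < 1) (hC : 0 < C) (x y : G) :
    subexpWeight hU hα0 hα1 hC (x * y) ≤
      subexpWeight hU hα0 hα1 hC x * subexpWeight hU hα0 hα1 hC y ^ α +
        subexpWeight hU hα0 hα1 hC x ^ α * subexpWeight hU hα0 hα1 hC y := by
  change Real.exp (C * (len U (x * y) : ℝ) ^ α) ≤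
    Real.exp (C * (len U x : ℝ) ^ α) * Real.exp (C * (len U y : ℝ) ^ α) ^ α +
      Real.exp (C * (len U x : ℝ) ^ α) ^ α * Real.exp (C * (len U y : ℝ) ^ α)
  have h : (len U (x * y) : ℝ) ≤ len U x + len U y := by exact_mod_cast hU.len_mul_le x y
  have h1 : (len U (x * y) : ℝ) ^ α ≤ (len U x + len U y : ℝ) ^ α :=
    Real.rpow_le_rpow (by positivity) h hα0.le
  simp only [← Real.exp_mul, ← Real.exp_add]
  rcases le_total (len U y : ℝ) (len U x) with hxy | hxy
  · refine le_add_of_le_of_nonneg (Real.exp_le_exp.2 ?_) (by positivity)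
    have h2 := add_rpow_le_rpow_add_mul_rpow (Nat.cast_nonneg _) hxy hα0.le hα1.le
    nlinarith
  · refine le_add_of_nonneg_of_le (by positivity) (Real.exp_le_exp.2 ?_)
    have h2 := add_rpow_le_rpow_add_mul_rpow (Nat.cast_nonneg _) hxy hα0.le hα1.le
    rw [add_comm (len U y : ℝ)] at h2
    nlinarith

theorem summable_exp_neg_mul_rpow {c α : ℝ} (hc : 0 < c) (hα : 0 < α) :
    Summable fun n : ℕ => Real.exp (-c * (n : ℝ) ^ α) := by
  -- With `t = n^α`, the comparison `exp(-ct) = o(t^(-2/α))` becomes domination by `n^(-2)`.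
  have h1 := (isLittleO_exp_neg_mul_rpow_atTop hc (-2 / α)).comp_tendsto
    ((tendsto_rpow_atTop hα).comp tendsto_natCast_atTop_atTop)
  refine summable_of_isBigO_nat (Real.summable_nat_rpow.2 (by norm_num : (-2 : ℝ) < -1))
    (h1.isBigO.congr_right fun n => ?_)
  simp only [Function.comp_apply]
  rw [← Real.rpow_mul (by positivity), mul_div_cancel₀ _ hα.ne']

/-- As `α₀ < α`, half of the decay `exp(-C s j^α)` absorbs the size of the ball `U^j`; the other
half is summable. Every `s > 0` is therefore admissible. -/
theorem tsum_subexpWeight_rpow_neg_ne_top {U : Set G} (hU : IsSymmGenSet U) {α₀ α C : ℝ}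
    (hα : 0 < α) (hα1 : α < 1) (hC : 0 < C) (h : α₀ < α)
    (hG : GrowthBoundedByExp U α₀) {s : ℝ} (hs0 : 0 < s) :
    ∑' x, (subexpWeight hU hα hα1 hC).ennreal x ^ (-s) ≠ ⊤ := by
  obtain ⟨K, hK0, hK⟩ := hG
  refine tsum_ennreal_rpow_neg_ne_top (F := fun j => U ^ j)
    (c := fun j => Real.exp (-(C * s) * (j : ℝ) ^ α)) (fun j => hU.finite_pow _)
    (fun j => by positivity) (fun x => ⟨len U x, hU.mem_pow_len x, ?_⟩) ?_
  · change Real.exp (C * (len U x : ℝ) ^ α) ^ (-s) ≤ _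
    rw [← Real.exp_mul]
    exact le_of_eq (by ring_nf)
  · have h1 : ∀ᶠ j : ℕ in Filter.atTop, (K * (j : ℝ)) ^ α₀ ≤ C * s / 2 * (j : ℝ) ^ α := by
      have h2 := ((tendsto_rpow_atTop (sub_pos.2 h)).comp
        (tendsto_natCast_atTop_atTop (R := ℝ))).eventually_ge_atTop (K ^ α₀ / (C * s / 2))
      filter_upwards [h2, Filter.eventually_ge_atTop 1] with j hj hj1
      have hj0 : (0 : ℝ) < j := by exact_mod_cast hj1
      rw [Function.comp_apply, div_le_iff₀' (by positivity)] at hj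
      rw [Real.mul_rpow hK0.le hj0.le]
      calc _ ≤ C * s / 2 * (j : ℝ) ^ (α - α₀) * (j : ℝ) ^ α₀ := by gcongr
        _ = _ := by rw [mul_assoc, ← Real.rpow_add hj0, sub_add_cancel]
    refine summable_of_isBigO_nat
      ((summable_exp_neg_mul_rpow (c := C * s / 2) (by positivity) hα).mul_left K)
      (Asymptotics.IsBigO.of_bound 1 ?_)
    filter_upwards [h1, Filter.eventually_ge_atTop 1] with j hj hj1
    rw [one_mul, Real.norm_of_nonneg (by positivity), Real.norm_of_nonneg (by positivity)]
    calc _ ≤ Real.exp (-(C * s) * (j : ℝ) ^ α) * (K * Real.exp ((K * (j : ℝ)) ^ α₀)) := by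
          gcongr
          exact hK j hj1
      _ = K * Real.exp (-(C * s) * (j : ℝ) ^ α + (K * (j : ℝ)) ^ α₀) := by
          rw [Real.exp_add]; ring
      _ ≤ _ := by
          gcongr
          linarith

theorem subexpWeight_admits {p : ℝ≥0∞} [Fact (1 ≤ p)] (hp : p ≠ ⊤)
    {U : Set G} (hU : IsSymmGenSet U) {α₀ α C : ℝ} (hα0 : 0 < α) (hα1 : α < 1) (hC : 0 < C)
    (h : α₀ < α) (hG : GrowthBoundedByExp U α₀) :
    AdmitsNormControlledInversion p (subexpWeight hU hα0 hα1 hC) := by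
  -- All `s > 0` being available, `s = (1 - α)/2` meets `s (1 - 1/p) < 1 - α` for every `p`.
  have hs0 : 0 < (1 - α) / 2 := by linarith
  refine admitsNormControlledInversion_of_weight hp (ENNReal.ofReal_ne_top (r := 1)) hα0.le hs0
    ?_ (Weight.ennreal_mul_le zero_le_one hα0.le fun x y => ?_)
    (tsum_subexpWeight_rpow_neg_ne_top hU hα0 hα1 hC h hG hs0)
  · have h1 : 0 ≤ 1 / p.toReal := by positivity
    nlinarith
  · rw [one_mul]
    exact subexpWeight_mul_le hU hα0 hα1 hC x y

theorem PolynomialGrowth.growthBoundedByExp {U : Set G} (hU : PolynomialGrowth U) {a : ℝ}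
    (ha : 0 < a) : GrowthBoundedByExp U a := by
  obtain ⟨d, K, hK0, hK⟩ := hU
  -- With `m ≥ d/a` one has `n^d ≤ (n^a)^m ≤ m! exp(n^a)`.
  set m := ⌈d / a⌉₊
  have hm : d ≤ a * m := by
    have := Nat.le_ceil (d / a)
    rwa [div_le_iff₀' ha] at this
  -- One constant serves both as prefactor and inside the power; the `1` makes it at least `1`, so
  -- that `n` is at most the constant times `n`.
  refine ⟨K * m.factorial + 1, by positivity, fun n hn => (hK n hn).trans ?_⟩
  have hn' : (1 : ℝ) ≤ n := by exact_mod_cast hn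
  have h1 : (n : ℝ) ^ d ≤ m.factorial * Real.exp ((n : ℝ) ^ a) := by
    calc (n : ℝ) ^ d = (n : ℝ) ^ (d : ℝ) := (Real.rpow_natCast _ _).symm
      _ ≤ (n : ℝ) ^ (a * m) := Real.rpow_le_rpow_of_exponent_le hn' hm
      _ = ((n : ℝ) ^ a) ^ m := by rw [Real.rpow_mul (by positivity), Real.rpow_natCast]
      _ ≤ _ := by
          have := Real.pow_div_factorial_le_exp ((n : ℝ) ^ a) (by positivity) m
          rwa [div_le_iff₀' (by positivity)] at this
  calc K * (n : ℝ) ^ d ≤ K * (m.factorial * Real.exp ((n : ℝ) ^ a)) := by gcongr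
    _ = K * m.factorial * Real.exp ((n : ℝ) ^ a) := by ring
    _ ≤ _ := by
        gcongr
        · linarith
        · exact le_mul_of_one_le_left (by positivity)
            (by linarith [show 0 ≤ K * m.factorial by positivity])

end ConcreteWeights

end WeightedConv

theorem corollary4p2 {G : Type u} [Group G] (p q : ℝ≥0∞) [Fact (1 ≤ p)] (hp : p ≠ ∞)
    (hpq : p⁻¹ + q⁻¹ = 1) :
    -- (i) locally finite groups with step weights
    (∀ (H : ℕ → Subgroup G) (hH : Monotone H) (hcov : ∀ x, ∃ i, x ∈ H i) (n : ℕ → ℝ)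
        (hn : Monotone n) (hn1 : ∀ i, 1 ≤ n i), (∀ i, Finite (H i)) →
      ∀ s : ℝ≥0∞, 0 < s → s < q →
        Memℓp (fun x => (WeightedConv.stepWeight hH hcov hn hn1 x)⁻¹) s →
        WeightedConv.AdmitsNormControlledInversion p
          (WeightedConv.stepWeight hH hcov hn hn1)) ∧
    -- (ii) polynomial growth, polynomial weights
    (∀ (U : Set G) (hU : WeightedConv.IsSymmGenSet U), WeightedConv.PolynomialGrowth U →
      ∀ (β : ℝ) (hβ : 0 < β), (WeightedConv.growthOrder U : ℝ≥0∞) / q < ENNReal.ofReal β →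
        WeightedConv.AdmitsNormControlledInversion p (WeightedConv.polyWeight hU hβ)) ∧
    -- (iii) polynomial growth, subexponential weights
    (∀ (U : Set G) (hU : WeightedConv.IsSymmGenSet U), WeightedConv.PolynomialGrowth U →
      ∀ (α C : ℝ) (hα0 : 0 < α) (hα1 : α < 1) (hC : 0 < C),
        WeightedConv.AdmitsNormControlledInversion p
          (WeightedConv.subexpWeight hU hα0 hα1 hC)) ∧
    -- (iv) intermediate growth, subexponential weights
    (∀ (U : Set G) (hU : WeightedConv.IsSymmGenSet U), WeightedConv.IntermediateGrowth U →
      ∀ α₀ : ℝ, 0 < α₀ → WeightedConv.GrowthBoundedByExp U α₀ →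
      ∀ (α C : ℝ) (hα0 : 0 < α) (hα1 : α < 1) (hC : 0 < C), α₀ < α →
        WeightedConv.AdmitsNormControlledInversion p
          (WeightedConv.subexpWeight hU hα0 hα1 hC)) := by
  refine ⟨?_, ?_, ?_, ?_⟩
  · intro H hH hcov n hn hn1 _ s hs0 hsq hs
    exact WeightedConv.stepWeight_admits hp hpq hH hcov hn hn1 hs0 hsq hs
  · intro U hU hpoly β hβ hd
    exact WeightedConv.polyWeight_admits hp hpq hU hpoly hβ hd
  · intro U hU hpoly α C hα0 hα1 hC
    -- Polynomial growth is bounded by `exp(n^a)` for every `a > 0`, so `α/2` can play the role of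
    -- `α₀`.
    exact WeightedConv.subexpWeight_admits hp hU hα0 hα1 hC (half_lt_self hα0)
      (hpoly.growthBoundedByExp (half_pos hα0))
  · intro U hU _ α₀ _ hG α C hα0 hα1 hC h
    exact WeightedConv.subexpWeight_admits hp hU hα0 hα1 hC h hG
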